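/- Let $m,n\ge 1$ be coprime integers and put $\delta=\frac{(m-1)(n-1)}2$. Young diagrams are drawn in French notation; the box in row $i$ and column $j$ ($i,j\ge 0$, rows counted from the bottom) has content $i-j$. **Parking functions.** An $m/n$-Dyck path is a Young diagram $D$ that fits under the diagonal of the rectangle with $n$ rows and $m$ columns, i.e. $m(i+1)+n(j+1)\le mn$ for each box $(i,j)$ of $D$. For $f:\{1,\dots,n\}\to\mathbb Z_{\ge0}$ let $D_f$ be the Young diagram whose row lengths are the values of $f$ in decreasing order, and let $\mathrm{PF}_{m/n}(D)$ be the set of $f$ with $D_f=D$. Each such $f$ corresponds to a standard tableau of shape $(D+(1)^n)\setminus D$ (labels decreasing from bottom to top in each column) in which label $k$ lies in a row of $D$ of length $f(k)$. The diagonal word of $f$ is the list of these labels in increasing order of the weights $-mi-nj$ (up to an additive constant) of their boxes $(i,j)$, and $\mathrm{ides}(f)$ is the descent set of the inverse of this permutation. **Affine permutations.** An $m$-stable affine permutation is a bijection $\omega:\mathbb Z\to\mathbb Z$ with $\omega(x+n)=\omega(x)+n$, $\sum_{i=1}^n\omega(i)=\frac{n(n+1)}2$ and $\omega(x+m)>\omega(x)$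 for all $x$. Put $\Delta_\omega=\{i:\omega(i)>0\}$, $M_\omega=\min\Delta_\omega$, give the box $(i,j)$ of $\mathbb Z^2$ the weight $l(i,j)=mn-m-n+M_\omega-mi-nj$, and let $D_\omega$ consist of the boxes $(i,j)$ with $0\le i<n$, $0\le j<m$ and $l(i,j)\in\Delta_\omega$. The parking function of $\omega$ takes at $\omega(a_i)$ the length of row $i$ of $D_\omega$, where $a_i$ is the weight of the rightmost box of this row (of the box in column $-1$ if the row is empty). This is a bijection from $m$-stable affine permutations to $m/n$-parking functions. Put $$\mathrm{dinv}(\omega)=\delta-\#\{(i,j): 1\le i\le n,\ i<j<i+m,\ \omega(i)>\omega(j)\},$$ and $\mathrm{dinv}(f)=\mathrm{dinv}(\omega)$ if $f$ is the parking function of $\omega$. With the fundamental quasisymmetric functions $Q_S(z)=\sum z_{i_1}\cdots z_{i_N}$, the sum over $i_1\le\dots\le i_N$ such that $i_k=i_{k+1}$ implies $k\notin S$, let $$\mathcal F(D;t)=\sum_{f\in \mathrm{PF}_{m/n}(D)}t^{\mathrm{dinv}(f)}\,Q_{\mathrm{ides}(f)}(z).$$ **Ribbon tableaux.** For a Young diagram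 $\kappa$ let $M(\kappa)\subset\mathbb Z$ be the set of contents of the boxes immediately to the left of the vertical boundary steps of $\kappa$, i.e. $M(\kappa)=\{i-\kappa_i+1 : i\ge0\}$, where $\kappa_i$ is the length of row $i$. An $m$-ribbon is a connected skew Young diagram with $m$ boxes and no $2\times2$ square; its content is the largest content of its boxes, and its spin is its number of rows minus $1$. A standard $m$-ribbon tableau $T\in\mathrm{SRT}(\nu,m)$ of shape $\nu=\mu\setminus\lambda$ is a tiling of $\nu$ by $m$-ribbons with an order $r_1\prec\dots\prec r_N$ such that each $\lambda\sqcup r_1\sqcup\dots\sqcup r_k$ is a Young diagram; $c(T)$ is the sequence of contents of $r_1,\dots,r_N$, $\mathrm{des}(c(T))$ its descent set, and $\mathrm{spin}(T)$ is the sum of the spins of the ribbons. A semistandard $m$-ribbon tableau $S\in\mathrm{SSRT}(\nu,m)$ is a tiling of $\nu$ by $m$-ribbons with a labelling $\tau$ of the ribbons by positive integers, such that the relation "$r\prec s$ iff $\tau(r)<\tau(s)$, or $\tau(r)=\tau(s)$ and the content of $r$ is less than that of $s$" is a total order that defines a standard $m$-ribbon tableau; $z^S=\prod_r z_{\tau(r)}$,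 and $\mathrm{spin}(S)$ is again the sum of the spins. The skew LLT polynomial of $\nu$ (in this convention) is $G_\nu(z;q)=\sum_{S\in\mathrm{SSRT}(\nu,m)}q^{\mathrm{spin}(S)}z^S$. **Theorem.** Let $D$ be an $m/n$-Dyck path. All $m$-stable affine permutations $\omega$ whose parking function lies in $\mathrm{PF}_{m/n}(D)$ have the same set $\Delta_\omega=:\Delta_D$, and there is a unique $m$-stable affine permutation $\omega_0$ with $\Delta_{\omega_0}=\Delta_D$ and $\omega_0^{-1}(1)<\dots<\omega_0^{-1}(n)$. There are Young diagrams $\lambda\subseteq\mu$ such that $M(\lambda)=\Delta_D$, $\lambda$ is both an $m$-core and an $n$-core (no box has hook length $m$ or $n$), and $M(\mu)$ is obtained from $\Delta_D$ by moving each $n$-generator $a\in\Delta_D\setminus(\Delta_D+n)$ to $a-m$, i.e. $M(\mu)=\{a-m: a\in\Delta_D\setminus(\Delta_D+n)\}\cup(\Delta_D+n)$. With $\nu=\mu\setminus\lambda$ and $e(D)=\frac12\left(\delta+\mathrm{dinv}(\omega_0)\right)$ one has $$\mathcal F(D;t)=t^{e(D)}\sum_{T\in\mathrm{SRT}(\nu,m)}t^{-\frac12\mathrm{spin}(T)}\,Q_{\mathrm{des}(c(T))}(z)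 =t^{e(D)}\sum_{S\in\mathrm{SSRT}(\nu,m)}t^{-\frac12\mathrm{spin}(S)}\,z^S=t^{e(D)}\,G_\nu(z;t^{-1/2}).$$ -/

import Mathlib

open Finset

noncomputable section

namespace RatShuffle

/-! ### Coefficients and quasisymmetric functions -/

/-- Coefficient ring: finite `ℤ`-linear combinations of powers `t ^ r` with rational exponents. -/
abbrev Coeff : Type := AddMonoidAlgebra ℤ ℚ

/-- The monomial `t ^ r`. -/
def tpow (r : ℚ) : Coeff := AddMonoidAlgebra.single r 1

/-- Formal power series in the variables `z₁, z₂, …` over `Coeff`. -/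
abbrev ZSeries : Type := MvPowerSeries ℕ+ Coeff

/-- The descent set of a word `w = w₁ w₂ … w_N`: all `k` with `1 ≤ k < N` and `w_k > w_{k+1}`.
The letter `w_k` is `w ⟨k - 1, _⟩`. -/
def descents {N : ℕ} {α : Type} [LinearOrder α] (w : Fin N → α) : Set ℕ :=
  {k | ∃ a b : Fin N, (a : ℕ) + 1 = k ∧ (b : ℕ) = k ∧ w b < w a}

/-- The index sequences `i₁ ≤ … ≤ i_N` with `i_k = i_{k+1} ⇒ k ∉ S` and monomial
`z_{i₁} ⋯ z_{i_N} = z ^ d`. -/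
def fundamentalIndices (N : ℕ) (S : Set ℕ) (d : ℕ+ →₀ ℕ) : Set (Fin N → ℕ+) :=
  {i | Monotone i ∧
    (∀ a b : Fin N, (a : ℕ) + 1 = (b : ℕ) → i a = i b → (a : ℕ) + 1 ∉ S) ∧
    ∑ a, Finsupp.single (i a) 1 = d}

/-- Gessel's fundamental quasisymmetric function `Q_S(z)` of degree `N`. -/
def fundamental (N : ℕ) (S : Set ℕ) : ZSeries :=
  fun d => ((fundamentalIndices N S d).ncard : Coeff)

/-! ### Rational parking functions

The cars `1, …, n` are the elements of `Fin n`, car `k + 1` being `k : Fin n`. Boxes are pairs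
`(row, column)`, rows being counted from the bottom and columns from the left (French notation). -/

/-- The diagram lies below the diagonal of the rectangle with `n` rows and `m` columns. -/
def FitsUnderDiagonal (m n : ℕ) (D : YoungDiagram) : Prop :=
  ∀ c ∈ D, m * (c.1 + 1) + n * (c.2 + 1) ≤ m * n

/-- The car in each row (from the bottom) of the standard tableau of shape `D_f + (1)^n ∖ D_f`
given by `f`: row lengths of `D_f` decrease from bottom to top, and labels in
the same column decrease from bottom to top. -/
def rowLabel {n : ℕ} (f : Fin n → ℕ) : Equiv.Perm (Fin n) :=
  Tuple.sort fun k => toLex (OrderDual.toDual (f k), OrderDual.toDual k)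

theorem antitone_comp_rowLabel {n : ℕ} (f : Fin n → ℕ) :
    Antitone fun r => f (rowLabel f r) := by
  intro r s h
  have h1 := Tuple.monotone_sort
    (fun k => toLex (OrderDual.toDual (f k), OrderDual.toDual k)) h
  have h2 := Prod.Lex.monotone_fst _ _ h1
  exact h2

theorem sortedGE_values {n : ℕ} (f : Fin n → ℕ) :
    (List.ofFn fun r => f (rowLabel f r)).SortedGE := by
  rw [List.sortedGE_iff_antitone_get]
  intro a b h
  have hab : (⟨a, by simpa using a.2⟩ : Fin n) ≤ ⟨b, by simpa using b.2⟩ := h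
  simpa using antitone_comp_rowLabel f hab

/-- `D_f`: the Young diagram whose row lengths are the values of `f` in decreasing order. -/
def diagram {n : ℕ} (f : Fin n → ℕ) : YoungDiagram :=
  YoungDiagram.ofRowLens (List.ofFn fun r => f (rowLabel f r)) (sortedGE_values f)

/-- The set of `m/n`-parking functions with underlying Dyck path `D`. -/
def parkingFunctions (m n : ℕ) (D : YoungDiagram) : Set (Fin n → ℕ) :=
  {f | FitsUnderDiagonal m n (diagram f) ∧ diagram f = D}

/-- The weight `mn - m - n + M - m·row - n·col` of a box. -/
def boxWeight (m n : ℕ) (M row col : ℤ) : ℤ :=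
  m * n - m - n + M - m * row - n * col

/-- `δ = (m - 1)(n - 1) / 2`. -/
def delta (m n : ℕ) : ℚ := ((m : ℚ) - 1) * ((n : ℚ) - 1) / 2

/-- `area(f) = (m - 1)(n - 1) / 2 - ∑ f(a)`. -/
def area (m : ℕ) {n : ℕ} (f : Fin n → ℕ) : ℤ :=
  ((m : ℤ) - 1) * ((n : ℤ) - 1) / 2 - ∑ a, (f a : ℤ)

/-- The weight of the box of the standard tableau of `f` that carries the label `k`; this box is
the first one to the right of `D_f` in its row. -/
def labelWeight (m : ℕ) {n : ℕ} (f : Fin n → ℕ) (k : Fin n) : ℤ :=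
  boxWeight m n (1 - area m f) (((rowLabel f).symm k : Fin n) : ℕ) (f k)

/-- The diagonal word: the labels of the tableau read in increasing order of their weights. -/
def diagonalWord (m : ℕ) {n : ℕ} (f : Fin n → ℕ) : Equiv.Perm (Fin n) :=
  Tuple.sort (labelWeight m f)

/-- The descent set of the inverse of the diagonal word. -/
def ides (m : ℕ) {n : ℕ} (f : Fin n → ℕ) : Set ℕ :=
  descents fun k => (diagonalWord m f).symm k

/-! ### Affine permutations and the map to parking functions -/

/-- Affine `S_n`-permutations `ω` with no inversions of height `m`. -/
def IsStable (m n : ℕ) (ω : Equiv.Perm ℤ) : Prop :=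
  (∀ x, ω (x + n) = ω x + n) ∧
  (∑ i ∈ Finset.Icc (1 : ℤ) n, ω i = (n : ℤ) * (n + 1) / 2) ∧
  ∀ x, ω x < ω (x + m)

/-- `Δ_ω = {i | ω(i) > 0}`. -/
def positiveSet (ω : Equiv.Perm ℤ) : Set ℤ := {i | 0 < ω i}

/-- `D_ω`: the boxes of the rectangle with `n` rows and `m` columns whose weight lies in `Δ_ω`,
where `M` in the weight is the minimal element of `Δ_ω`. -/
def stableDiagram (m n : ℕ) (ω : Equiv.Perm ℤ) : Set (ℕ × ℕ) :=
  {c | c.1 < n ∧ c.2 < m ∧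
    boxWeight m n (sInf (positiveSet ω)) c.1 c.2 ∈ positiveSet ω}

/-- The length of the row of `D_ω` with index `i`. -/
def stableRowLen (m n : ℕ) (ω : Equiv.Perm ℤ) (i : ℕ) : ℕ :=
  {j : ℕ | (i, j) ∈ stableDiagram m n ω}.ncard

/-- The weight of the rightmost box of the row of `D_ω` with index `i` (the box in column `-1`
if that row is empty). -/
def stableRowWeight (m n : ℕ) (ω : Equiv.Perm ℤ) (i : ℕ) : ℤ :=
  boxWeight m n (sInf (positiveSet ω)) i ((stableRowLen m n ω i : ℤ) - 1)

/-- `f` is the parking function attached to `ω`: the row with index `i` of `D_ω` is labelled by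
the car `ω(a_i)`, where `a_i` is the weight of its rightmost box, and `f` sends this car to the
length of the row. -/
def IsAnderson (m n : ℕ) (ω : Equiv.Perm ℤ) (f : Fin n → ℕ) : Prop :=
  ∀ i : Fin n, ∃ k : Fin n,
    ω (stableRowWeight m n ω i) = (k : ℤ) + 1 ∧ f k = stableRowLen m n ω i

/-- `dinv(ω)`: `δ` minus the number of inversions of `ω` of height less than `m`. -/
def dinvPerm (m n : ℕ) (ω : Equiv.Perm ℤ) : ℚ :=
  delta m n -
    ({p : ℤ × ℤ | 1 ≤ p.1 ∧ p.1 ≤ n ∧ p.1 < p.2 ∧ p.2 < p.1 + m ∧ ω p.2 < ω p.1}.ncard : ℚ)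

open Classical in
/-- `dinv(f) = dinv(ω)` for the `m`-stable affine permutation `ω` attached to `f`. -/
def dinv (m n : ℕ) (f : Fin n → ℕ) : ℚ :=
  if h : ∃ ω, IsStable m n ω ∧ IsAnderson m n ω f then dinvPerm m n h.choose else 0

/-- `F(D; t) = ∑ t ^ dinv(f) Q_{ides(f)}(z)` over the `m/n`-parking functions `f` with underlying
Dyck path `D`. -/
def dyckSeries (m n : ℕ) (D : YoungDiagram) : ZSeries :=
  ∑ᶠ f ∈ parkingFunctions m n D, tpow (dinv m n f) • fundamental n (ides m f)

/-- `Δ_D`: the common set `Δ_ω` of all `m`-stable `ω` whose parking function has underlying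
Dyck path `D` (written as the union of these sets). -/
def dyckSet (m n : ℕ) (D : YoungDiagram) : Set ℤ :=
  {x | ∃ ω, IsStable m n ω ∧ (∃ f ∈ parkingFunctions m n D, IsAnderson m n ω f) ∧
    x ∈ positiveSet ω}

/-- `ω` is an `m`-stable affine permutation with `Δ_ω = Δ` and
`ω⁻¹(1) < ω⁻¹(2) < ⋯ < ω⁻¹(n)`. -/
def IsIncreasingStable (m n : ℕ) (Δ : Set ℤ) (ω : Equiv.Perm ℤ) : Prop :=
  IsStable m n ω ∧ positiveSet ω = Δ ∧
    StrictMono fun k : Fin n => ω.symm ((k : ℤ) + 1)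

/-! ### Young diagrams, Maya sets, cores -/

/-- The content of the box in row `c.1` and column `c.2`. -/
def boxContent (c : ℕ × ℕ) : ℤ := (c.1 : ℤ) - (c.2 : ℤ)

/-- `M(κ)`: the contents of the boxes immediately to the left of the vertical steps of the
boundary of `κ`; in row `i` this box has column `rowLen i - 1` (possibly `-1`). -/
def mayaSet (κ : YoungDiagram) : Set ℤ :=
  Set.range fun i : ℕ => (i : ℤ) - ((κ.rowLen i : ℤ) - 1)

/-- The number of boxes in the hook of `c`: those weakly to the right in the same row and
those strictly above in the same column. -/
def hookLength (κ : YoungDiagram) (c : ℕ × ℕ) : ℕ :=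
  (κ.cells.filter fun b => (b.1 = c.1 ∧ c.2 ≤ b.2) ∨ (b.2 = c.2 ∧ c.1 < b.1)).card

/-- `κ` is an `m`-core: no box has hook length `m`. -/
def IsCore (m : ℕ) (κ : YoungDiagram) : Prop := ∀ c ∈ κ, hookLength κ c ≠ m

/-- The set obtained from `Δ` by moving each `n`-generator `a ∈ Δ ∖ (Δ + n)` to `a - m`. -/
def jumpSet (m n : ℕ) (Δ : Set ℤ) : Set ℤ :=
  (fun a => a - (m : ℤ)) '' (Δ \ ((fun a => a + (n : ℤ)) '' Δ)) ∪ (fun a => a + (n : ℤ)) '' Δ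

/-! ### Ribbon tableaux -/

/-- Two boxes are adjacent when they share an edge. -/
def boxGraph : SimpleGraph (ℕ × ℕ) := (SimpleGraph.hasse ℕ).boxProd (SimpleGraph.hasse ℕ)

/-- An `m`-ribbon: a connected skew Young diagram of area `m` with no `2 × 2` square. -/
structure IsRibbon (m : ℕ) (r : Finset (ℕ × ℕ)) : Prop where
  skew : ∃ lam mu : YoungDiagram, lam ≤ mu ∧ r = mu.cells \ lam.cells
  area : r.card = m
  connected : (boxGraph.induce (r : Set (ℕ × ℕ))).Connected
  no_square : ¬ ∃ i j : ℕ, (i, j) ∈ r ∧ (i + 1, j) ∈ r ∧ (i, j + 1) ∈ r ∧ (i + 1, j + 1) ∈ r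

/-- The content of a ribbon: the maximum of the contents of its boxes. -/
def ribbonContent (r : Finset (ℕ × ℕ)) : ℤ := sSup (boxContent '' (r : Set (ℕ × ℕ)))

/-- The height of a ribbon: the number of rows that it meets. -/
def ribbonHeight (r : Finset (ℕ × ℕ)) : ℕ := (r.image Prod.fst).card

/-- The spin of a ribbon is its height minus one. -/
def ribbonSpin (r : Finset (ℕ × ℕ)) : ℕ := ribbonHeight r - 1

/-- A standard `m`-ribbon tableau of shape `mu ∖ lam`: a tiling of the shape by `m`-ribbons,
listed in an order `r₁ ≺ ⋯ ≺ r_N` such that each partial union `lam ∪ r₁ ∪ ⋯ ∪ r_k` is a Young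
diagram. -/
structure StandardRibbonTableau (m : ℕ) (lam mu : YoungDiagram) where
  size : ℕ
  ribbon : Fin size → Finset (ℕ × ℕ)
  isRibbon : ∀ i, IsRibbon m (ribbon i)
  disjoint : ∀ i j, i ≠ j → Disjoint (ribbon i) (ribbon j)
  cover : Finset.univ.biUnion ribbon = mu.cells \ lam.cells
  young : ∀ k ≤ size, ∃ κ : YoungDiagram,
    κ.cells = lam.cells ∪ (Finset.univ.filter fun i : Fin size => (i : ℕ) < k).biUnion ribbon

/-- The spin of a standard ribbon tableau: the sum of the spins of its ribbons. -/
def StandardRibbonTableau.spin {m : ℕ} {lam mu : YoungDiagram}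
    (T : StandardRibbonTableau m lam mu) : ℕ := ∑ i, ribbonSpin (T.ribbon i)

/-- The content sequence of a standard ribbon tableau. -/
def StandardRibbonTableau.contents {m : ℕ} {lam mu : YoungDiagram}
    (T : StandardRibbonTableau m lam mu) : Fin T.size → ℤ := fun i => ribbonContent (T.ribbon i)

/-- The relation `r ≺ s` defined by a labelling `τ` of a set of ribbons, refined by content. -/
def RibbonPrec {R : Finset (Finset (ℕ × ℕ))} (τ : {r // r ∈ R} → ℕ+) (r s : {r // r ∈ R}) : Prop :=
  τ r < τ s ∨ (τ r = τ s ∧ ribbonContent r < ribbonContent s)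

/-- A semistandard `m`-ribbon tableau of shape `mu ∖ lam`: a tiling of the shape by `m`-ribbons
with positive integer labels `τ`, such that the relation `≺` is a total order on the ribbons and
defines a standard `m`-ribbon tableau. -/
structure SemistandardRibbonTableau (m : ℕ) (lam mu : YoungDiagram) where
  ribbons : Finset (Finset (ℕ × ℕ))
  isRibbon : ∀ r ∈ ribbons, IsRibbon m r
  disjoint : ∀ r ∈ ribbons, ∀ s ∈ ribbons, r ≠ s → Disjoint r s
  cover : ribbons.biUnion id = mu.cells \ lam.cells
  label : {r // r ∈ ribbons} → ℕ+
  total : ∀ r s, r ≠ s → RibbonPrec label r s ∨ RibbonPrec label s r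
  standard : ∃ (T : StandardRibbonTableau m lam mu) (h : ∀ i, T.ribbon i ∈ ribbons),
    (∀ r ∈ ribbons, ∃ i, T.ribbon i = r) ∧
    ∀ i j, i < j → RibbonPrec label ⟨T.ribbon i, h i⟩ ⟨T.ribbon j, h j⟩

/-- The spin of a semistandard ribbon tableau: the sum of the spins of its ribbons. -/
def SemistandardRibbonTableau.spin {m : ℕ} {lam mu : YoungDiagram}
    (S : SemistandardRibbonTableau m lam mu) : ℕ := ∑ r ∈ S.ribbons, ribbonSpin r

/-- The exponent of the monomial `z ^ S = ∏ z_{τ(r)}` over the ribbons `r` of `S`. -/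
def SemistandardRibbonTableau.weight {m : ℕ} {lam mu : YoungDiagram}
    (S : SemistandardRibbonTableau m lam mu) : ℕ+ →₀ ℕ :=
  ∑ r : {r // r ∈ S.ribbons}, Finsupp.single (S.label r) 1

/-- The skew LLT polynomial of the shape `mu ∖ lam`: the sum of `q ^ spin(S) z ^ S` over all
semistandard `m`-ribbon tableaux `S` of this shape. -/
def skewLLT (m : ℕ) (lam mu : YoungDiagram) (q : Coeff) : ZSeries :=
  fun d => ∑ᶠ (S : SemistandardRibbonTableau m lam mu) (_ : S.weight = d), q ^ S.spin

/-! ### The counts and sums above are finite -/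

theorem label_mem_support {A : Type} [Fintype A] {i : A → ℕ+} {d : ℕ+ →₀ ℕ}
    (h : ∑ a, Finsupp.single (i a) 1 = d) (a : A) : i a ∈ d.support := by
  classical
  have h1 : (Finsupp.single (i a) 1 : ℕ+ →₀ ℕ) ≤ d := by
    rw [← h]
    exact Finset.single_le_sum (f := fun a => (Finsupp.single (i a) 1 : ℕ+ →₀ ℕ))
      (fun _ _ => zero_le) (Finset.mem_univ a)
  have h2 := h1 (i a)
  simp only [Finsupp.single_eq_same] at h2
  simp only [Finsupp.mem_support_iff]
  omega

theorem finite_fundamentalIndices (N : ℕ) (S : Set ℕ) (d : ℕ+ →₀ ℕ) :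
    (fundamentalIndices N S d).Finite := by
  refine (Set.Finite.pi' (ι := Fin N) (t := fun _ => (d.support : Set ℕ+))
    fun _ => d.support.finite_toSet).subset ?_
  rintro i ⟨-, -, h⟩ a
  exact label_mem_support h a

theorem finite_parkingFunctions (m n : ℕ) (D : YoungDiagram) :
    (parkingFunctions m n D).Finite := by
  refine (Set.Finite.pi' (ι := Fin n) (t := fun _ => Set.Iic (D.rowLen 0))
    fun _ => Set.finite_Iic _).subset ?_
  rintro f ⟨-, h⟩ k
  rw [Set.mem_Iic]
  by_contra hk
  push Not at hk
  have h1 : (((rowLabel f).symm k : Fin n).val, D.rowLen 0) ∈ diagram f := by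
    rw [diagram, YoungDiagram.mem_ofRowLens]
    refine ⟨by simp, ?_⟩
    simpa using hk
  rw [h, YoungDiagram.mem_iff_lt_rowLen] at h1
  have h2 := D.rowLen_anti 0 ((rowLabel f).symm k : Fin n).val (Nat.zero_le _)
  omega

theorem IsRibbon.nonempty {m : ℕ} {r : Finset (ℕ × ℕ)} (h : IsRibbon m r) : r.Nonempty := by
  obtain ⟨⟨c, hc⟩⟩ := h.connected.nonempty
  exact ⟨c, hc⟩

instance (m : ℕ) (lam mu : YoungDiagram) : Finite (StandardRibbonTableau m lam mu) := by
  classical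
  set B := mu.cells \ lam.cells with hB
  have hsub : ∀ T : StandardRibbonTableau m lam mu, ∀ i, T.ribbon i ∈ B.powerset := by
    intro T i
    rw [Finset.mem_powerset, hB, ← T.cover]
    exact Finset.subset_biUnion_of_mem T.ribbon (Finset.mem_univ i)
  have hinj : ∀ T : StandardRibbonTableau m lam mu, Function.Injective T.ribbon := by
    intro T i j hij
    by_contra hne
    have h1 := T.disjoint i j hne
    rw [hij, disjoint_self] at h1
    exact (T.isRibbon j).nonempty.ne_empty h1
  have hsize : ∀ T : StandardRibbonTableau m lam mu, T.size < B.powerset.card + 1 := by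
    intro T
    have h1 := Finset.card_le_card_of_injOn (s := Finset.univ) (t := B.powerset) T.ribbon
      (fun i _ => hsub T i) ((hinj T).injOn)
    simp only [Finset.card_univ, Fintype.card_fin] at h1
    omega
  let g : StandardRibbonTableau m lam mu →
      Σ N : Fin (B.powerset.card + 1), (Fin N → {r // r ∈ B.powerset}) :=
    fun T => ⟨⟨T.size, hsize T⟩, fun i => ⟨T.ribbon i, hsub T i⟩⟩
  refine Finite.of_injective g ?_
  rintro ⟨N, r, _, _, _, _⟩ ⟨N', r', _, _, _, _⟩ h
  simp only [g, Sigma.mk.injEq, Fin.mk.injEq] at h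
  obtain ⟨rfl, h⟩ := h
  have h3 : r = r' := by
    funext i
    have h2 := congrFun (eq_of_heq h) i
    exact congrArg Subtype.val h2
  subst h3
  rfl

theorem finite_weight_eq (m : ℕ) (lam mu : YoungDiagram) (d : ℕ+ →₀ ℕ) :
    {S : SemistandardRibbonTableau m lam mu | S.weight = d}.Finite := by
  classical
  set B := mu.cells \ lam.cells with hB
  have hsub : ∀ S : SemistandardRibbonTableau m lam mu, S.ribbons ∈ B.powerset.powerset := by
    intro S
    rw [Finset.mem_powerset]
    intro r hr
    rw [Finset.mem_powerset, hB, ← S.cover]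
    exact Finset.subset_biUnion_of_mem id hr
  let g : {S : SemistandardRibbonTableau m lam mu | S.weight = d} →
      Σ R : {R // R ∈ B.powerset.powerset}, ({r // r ∈ R.1} → {k // k ∈ d.support}) :=
    fun S => ⟨⟨S.1.ribbons, hsub S.1⟩, fun r => ⟨S.1.label r, label_mem_support S.2 r⟩⟩
  refine Set.finite_coe_iff.mp (Finite.of_injective g ?_)
  rintro ⟨⟨R, _, _, _, l, _, _⟩, _⟩ ⟨⟨R', _, _, _, l', _, _⟩, _⟩ h
  simp only [g, Sigma.mk.injEq, Subtype.mk.injEq] at h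
  obtain ⟨rfl, h⟩ := h
  have h3 : l = l' := by
    funext i
    have h2 := congrFun (eq_of_heq h) i
    exact congrArg Subtype.val h2
  subst h3
  rfl

end RatShuffle

end

open RatShuffle

noncomputable section

namespace RatShuffle

/-! ### Maya sets and counting functions of Young diagrams -/

/-! Both sides of the identity are sums over the same set of orderings of `n` integers. Let `A i` be
the weight of the rightmost box of row `i` of `D`, suitably normalised. These generators are
pairwise incongruent modulo `n`, their sum is `1 + ... + n`, and Δ_D is the set of all `A i + n k`
with `k ≥ 0`. An `m`-stable ω with Δ_ω = Δ_D takes the values `1, ..., n` on the generators, hence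
is an ordering `e` of them, and stability means that `A i` precedes `A i + m` whenever both are
generators (`IsAdmissible`). Such pairs come from adjacent rows of equal length, so admissibility is
the column condition on the tableau of a parking function, and `rowLabel` is a bijection from the
parking functions over `D` to the admissible orderings (`bijOn_rowLabel`).

A diagram is encoded by `rowCount κ c`, which counts the elements of the Maya set up to `c` and is
also the row of the first box outside `κ` on the diagonal of content `c`. Adding an `m`-ribbon adds
1 to this function on some interval `a - m ≤ c < a`, that is, moves `a` to the free place `a - m`.
The ribbon has content `a - 1`, and its spin is the number of Maya elements strictly between the two
places. A standard tableau is thus a sequence of moves from Δ_D to M(μ). The multiset of moved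
elements depends only on the shape, so each generator moves exactly once; a generator can move only
when its target is free, which again is admissibility (`IsResidueSystem.tableau_bijective`).

For the exponents, let g count the pairs of a generator and a larger gap of Δ_D at distance less
than `m`, and v the inversions of height less than `m` between generators. Charging inversions of ω
to their left ends gives dinv = δ - g - v, with v = 0 for ω₀. The spin counts the inversions at
their right ends, g + v in total, and also v places `A j - m` already taken
(`IsResidueSystem.sum_card_movedSet`). Hence spin = g + 2v and e(D) - spin/2 = δ - g - v. Descent
sets agree because the contents of the tableau and the weights read by the diagonal word are both
the generators up to a constant.

Finally, a semistandard tableau is a standard one with a weakly increasing labelling that is strict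
at descents of the contents, which turns the fundamental expansion into the LLT polynomial
(`skewLLT_eq_finsum`). -/

/-- The element of `mayaSet κ` that belongs to row `i`. -/
def rowEntry (κ : YoungDiagram) (i : ℕ) : ℤ := (i : ℤ) - ((κ.rowLen i : ℤ) - 1)

theorem rowEntry_strictMono (κ : YoungDiagram) : StrictMono (rowEntry κ) := by
  refine strictMono_nat_of_lt_succ fun i => ?_
  have := κ.rowLen_anti i (i + 1) (Nat.le_succ i)
  simp only [rowEntry]
  push_cast
  omega

theorem mem_mayaSet {κ : YoungDiagram} {x : ℤ} : x ∈ mayaSet κ ↔ ∃ i, rowEntry κ i = x := Iff.rfl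

theorem mayaSet_injective : Function.Injective mayaSet := by
  intro κ κ' h
  have h1 : rowEntry κ = rowEntry κ' :=
    ((rowEntry_strictMono κ).range_inj (rowEntry_strictMono κ')).1 h
  have h2 : ∀ i, κ.rowLen i = κ'.rowLen i := by
    intro i
    have := congrFun h1 i
    simp only [rowEntry] at this
    omega
  ext ⟨i, j⟩
  simp [YoungDiagram.mem_cells, YoungDiagram.mem_iff_lt_rowLen, h2]

theorem exists_lt_rowEntry (κ : YoungDiagram) (c : ℤ) : ∃ i, c < rowEntry κ i := by
  have h : ∀ i : ℕ, rowEntry κ 0 + i ≤ rowEntry κ i := by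
    intro i
    induction i with
    | zero => simp
    | succ i ih =>
      have := rowEntry_strictMono κ (Nat.lt_add_one i)
      push_cast
      omega
  refine ⟨(c - rowEntry κ 0 + 1).toNat, ?_⟩
  have := h (c - rowEntry κ 0 + 1).toNat
  omega

/-- The number of elements of `mayaSet κ` that are at most `c`. -/
def rowCount (κ : YoungDiagram) (c : ℤ) : ℕ := Nat.find (exists_lt_rowEntry κ c)

theorem lt_rowCount {κ : YoungDiagram} {c : ℤ} {i : ℕ} : i < rowCount κ c ↔ rowEntry κ i ≤ c := by
  rw [rowCount, Nat.lt_find_iff]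
  constructor
  · intro h
    have := h i le_rfl
    omega
  · intro h k hk
    have := (rowEntry_strictMono κ).monotone hk
    omega

/-- The boxes of `κ` on one diagonal form an initial segment, and `rowCount` is the row in which it
ends. Containment and skew shapes can therefore be treated one content at a time. -/
theorem mem_iff_lt_rowCount {κ : YoungDiagram} {i j : ℕ} :
    (i, j) ∈ κ ↔ i < rowCount κ ((i : ℤ) - j) := by
  rw [lt_rowCount, YoungDiagram.mem_iff_lt_rowLen, rowEntry]
  omega

/-- Ensures that the first box outside `κ` on the diagonal of content `c` has a nonnegative column,
so that truncating `rowCount κ c - c` to a natural number is harmless. -/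
theorem le_rowCount (κ : YoungDiagram) (c : ℤ) : c ≤ rowCount κ c := by
  by_contra! h
  have h1 : ¬ rowCount κ c < rowCount κ c := lt_irrefl _
  rw [lt_rowCount, rowEntry] at h1
  omega

theorem rowCount_rowEntry_sub_one (κ : YoungDiagram) (i : ℕ) :
    rowCount κ (rowEntry κ i - 1) = i := by
  apply le_antisymm
  · by_contra! h
    rw [lt_rowCount] at h
    omega
  · by_contra! h
    have h1 : ¬ rowCount κ (rowEntry κ i - 1) < rowCount κ (rowEntry κ i - 1) := lt_irrefl _
    rw [lt_rowCount] at h1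
    have := rowEntry_strictMono κ h
    omega

theorem rowCount_rowEntry (κ : YoungDiagram) (i : ℕ) :
    rowCount κ (rowEntry κ i) = i + 1 := by
  have h0 : i < rowCount κ (rowEntry κ i) := lt_rowCount.2 le_rfl
  have h1 : ¬ i + 1 < rowCount κ (rowEntry κ i) := by
    rw [lt_rowCount]
    have := rowEntry_strictMono κ (Nat.lt_succ_self i)
    exact not_le.2 this
  omega

theorem rowCount_of_mem {κ : YoungDiagram} {x : ℤ} (h : x ∈ mayaSet κ) :
    rowCount κ x = rowCount κ (x - 1) + 1 := by
  obtain ⟨i, rfl⟩ := mem_mayaSet.1 h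
  rw [rowCount_rowEntry, rowCount_rowEntry_sub_one]

theorem rowCount_of_notMem {κ : YoungDiagram} {x : ℤ} (h : x ∉ mayaSet κ) :
    rowCount κ x = rowCount κ (x - 1) := by
  apply eq_of_forall_lt_iff
  intro i
  rw [lt_rowCount, lt_rowCount]
  have : rowEntry κ i ≠ x := fun h1 => h (mem_mayaSet.2 ⟨i, h1⟩)
  omega

theorem mem_mayaSet_iff {κ : YoungDiagram} {x : ℤ} :
    x ∈ mayaSet κ ↔ rowCount κ x = rowCount κ (x - 1) + 1 := by
  refine ⟨rowCount_of_mem, fun h => ?_⟩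
  by_contra h1
  have := rowCount_of_notMem h1
  omega

theorem rowCount_succ (κ : YoungDiagram) (c : ℤ) :
    rowCount κ (c + 1) = rowCount κ c ∨ rowCount κ (c + 1) = rowCount κ c + 1 := by
  by_cases h : c + 1 ∈ mayaSet κ
  · right; simpa using rowCount_of_mem h
  · left; simpa using rowCount_of_notMem h

theorem rowCount_eq_zero {κ : YoungDiagram} {c : ℤ} (h : c < rowEntry κ 0) : rowCount κ c = 0 := by
  by_contra h1
  have := lt_rowCount.1 (Nat.pos_of_ne_zero h1)
  omega

theorem rowCount_eq_self {κ : YoungDiagram} {c : ℤ} (h : (κ.colLen 0 : ℤ) ≤ c) :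
    (rowCount κ c : ℤ) = c := by
  apply le_antisymm _ (le_rowCount κ c)
  by_contra! h1
  have h2 : c.toNat < rowCount κ c := by omega
  rw [lt_rowCount, rowEntry] at h2
  have h3 : κ.rowLen c.toNat = 0 := by
    by_contra h4
    have h5 : (c.toNat, 0) ∈ κ := YoungDiagram.mem_iff_lt_rowLen.2 (Nat.pos_of_ne_zero h4)
    rw [YoungDiagram.mem_iff_lt_colLen] at h5
    omega
  rw [h3] at h2
  omega

theorem monotone_of_step {R : ℤ → ℕ} (h : ∀ c, R (c + 1) = R c ∨ R (c + 1) = R c + 1) :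
    Monotone R := by
  refine monotone_int_of_le_succ fun c => ?_
  rcases h c with h | h <;> omega

/-- Going down a column by `k` lowers the content by `k` and `R` by at most `k`; going left raises
the content, and `R` is monotone. So the boxes under `R` form a lower set. The normalisation `R c =
c` for large `c` fixes the charge. -/
theorem exists_diagram_rowCount {R : ℤ → ℕ} (hR : ∀ c, R (c + 1) = R c ∨ R (c + 1) = R c + 1)
    {K : ℕ} (h0 : ∀ c ≤ -(K : ℤ), R c = 0) (h1 : ∀ c ≥ (K : ℤ), (R c : ℤ) = c) :
    ∃ κ : YoungDiagram, ∀ c, rowCount κ c = R c := by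
  have hmono := monotone_of_step hR
  have hanti : ∀ (c : ℤ) (k : ℕ), (R (c + k) : ℤ) ≤ R c + k := by
    intro c k
    induction k with
    | zero => simp
    | succ k ih =>
      have := hR (c + k)
      push_cast
      rw [← add_assoc]
      rcases this with h | h <;> rw [h] <;> push_cast <;> omega
  have hge : ∀ c, c ≤ R c := by
    intro c
    have h2 := hanti c (K - c).toNat
    have h3 := h1 (c + (K - c).toNat) (by omega)
    omega
  -- Boxes below `R` have contents strictly between `-K` and `K` and lie in rows below `R K = K`, so
  -- `2 * K` columns suffice.
  let κ : YoungDiagram :=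
    { cells := ((Finset.range K) ×ˢ (Finset.range (2 * K))).filter
        fun b => b.1 < R ((b.1 : ℤ) - b.2)
      isLowerSet := by
        rintro ⟨i, j⟩ ⟨i', j'⟩ ⟨hi, hj⟩ h
        simp only [Finset.coe_filter, Finset.mem_product, Finset.mem_range, Set.mem_ofPred_eq]
          at h hi hj ⊢
        refine ⟨⟨by omega, by omega⟩, ?_⟩
        have h2 := hanti ((i' : ℤ) - j) (i - i')
        have h3 := hmono (show (i' : ℤ) - j ≤ (i' : ℤ) - j' by omega)
        have h4 : (i' : ℤ) - j + ((i - i' : ℕ) : ℤ) = (i : ℤ) - j := by omega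
        rw [h4] at h2
        omega }
  have hκ : ∀ i j, (i, j) ∈ κ ↔ i < R ((i : ℤ) - j) := by
    intro i j
    rw [← YoungDiagram.mem_cells]
    simp only [κ, Finset.mem_filter, Finset.mem_product, Finset.mem_range, and_iff_right_iff_imp]
    intro h
    have h2 : (i : ℤ) - j < K := by
      by_contra! h2
      have := h1 _ h2
      omega
    have h3 : -(K : ℤ) < (i : ℤ) - j := by
      by_contra! h3
      have := h0 _ h3
      omega
    have h4 := hmono h2.le
    have h5 := h1 K le_rfl
    omega
  refine ⟨κ, fun c => eq_of_forall_lt_iff fun i => ?_⟩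
  rcases lt_or_ge (i : ℤ) c with h | h
  · have h2 := hge c
    have h3 := le_rowCount κ c
    constructor <;> intro _ <;> omega
  · have h2 := @mem_iff_lt_rowCount κ i (i - c).toNat
    rw [hκ, show (i : ℤ) - ((i - c).toNat : ℤ) = c by omega] at h2
    exact h2.symm

/-! ### Ribbons -/

/-- `κ'` arises from `κ` by adding one box of each content `c` with `a - m ≤ c < a`. -/
def RibbonStep (m : ℕ) (κ κ' : YoungDiagram) (a : ℤ) : Prop :=
  ∀ c, rowCount κ' c = rowCount κ c + if a - m ≤ c ∧ c < a then 1 else 0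

theorem le_iff_rowCount_le {κ κ' : YoungDiagram} :
    κ ≤ κ' ↔ ∀ c, rowCount κ c ≤ rowCount κ' c := by
  constructor
  · intro h c
    by_contra! h1
    have h2 := le_rowCount κ' c
    have h3 := @mem_iff_lt_rowCount κ (rowCount κ' c) (rowCount κ' c - c).toNat
    have h4 := @mem_iff_lt_rowCount κ' (rowCount κ' c) (rowCount κ' c - c).toNat
    rw [show (rowCount κ' c : ℤ) - ((rowCount κ' c - c).toNat : ℤ) = c by omega] at h3 h4
    exact lt_irrefl _ (h4.1 (h (h3.2 h1)))
  · rintro h ⟨i, j⟩ hc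
    have hc' : (i, j) ∈ κ := hc
    show (i, j) ∈ κ'
    rw [mem_iff_lt_rowCount] at hc' ⊢
    exact hc'.trans_le (h _)

theorem mem_sdiff_cells {κ κ' : YoungDiagram} {i j : ℕ} :
    (i, j) ∈ κ'.cells \ κ.cells ↔
      rowCount κ ((i : ℤ) - j) ≤ i ∧ i < rowCount κ' ((i : ℤ) - j) := by
  rw [Finset.mem_sdiff, YoungDiagram.mem_cells, YoungDiagram.mem_cells, mem_iff_lt_rowCount,
    mem_iff_lt_rowCount]
  omega

namespace RibbonStep

variable {m : ℕ} {κ κ' : YoungDiagram} {a : ℤ}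

theorem le (h : RibbonStep m κ κ' a) : κ ≤ κ' :=
  le_iff_rowCount_le.2 fun c => by rw [h c]; omega

theorem mem_sdiff_cells (h : RibbonStep m κ κ' a) {i j : ℕ} :
    (i, j) ∈ κ'.cells \ κ.cells ↔
      rowCount κ ((i : ℤ) - j) = i ∧ a - m ≤ (i : ℤ) - j ∧ (i : ℤ) - j < a := by
  rw [RatShuffle.mem_sdiff_cells, h]
  split_ifs <;> omega

theorem image_boxContent (h : RibbonStep m κ κ' a) :
    (κ'.cells \ κ.cells).image boxContent = Finset.Ico (a - m) a := by
  ext c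
  simp only [Finset.mem_image, Finset.mem_Ico, boxContent, Prod.exists]
  constructor
  · rintro ⟨i, j, hij, rfl⟩
    exact (h.mem_sdiff_cells.1 hij).2
  · intro hc
    have h2 := le_rowCount κ c
    have h3 : (rowCount κ c : ℤ) - ((rowCount κ c - c).toNat : ℤ) = c := by omega
    refine ⟨rowCount κ c, (rowCount κ c - c).toNat, ?_, h3⟩
    rw [h.mem_sdiff_cells, h3]
    exact ⟨rfl, hc⟩

theorem injOn_boxContent (h : RibbonStep m κ κ' a) :
    Set.InjOn boxContent (κ'.cells \ κ.cells : Finset (ℕ × ℕ)) := by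
  rintro ⟨i, j⟩ h1 ⟨i', j'⟩ h2 h3
  rw [Finset.mem_coe, h.mem_sdiff_cells] at h1 h2
  simp only [boxContent] at h3
  rw [h3] at h1
  have : i = i' := by omega
  subst this
  have : j = j' := by omega
  subst this
  rfl

theorem card_sdiff (h : RibbonStep m κ κ' a) : (κ'.cells \ κ.cells).card = m := by
  rw [← Finset.card_image_of_injOn h.injOn_boxContent, h.image_boxContent]
  simp

/-- From content `c` to `c + 1` the value of `rowCount κ` either stays, and the next box lies to the
left, or grows by one, and the next box lies above. The ribbon is thus a path with consecutive
contents. -/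
theorem connected (h : RibbonStep m κ κ' a) (hm : 0 < m) :
    (boxGraph.induce ((κ'.cells \ κ.cells : Finset (ℕ × ℕ)) : Set (ℕ × ℕ))).Connected := by
  have hne : (κ'.cells \ κ.cells).Nonempty := by
    rw [← Finset.card_pos, h.card_sdiff]
    exact hm
  have key : ∀ (k : ℕ) (x y : ((κ'.cells \ κ.cells : Finset (ℕ × ℕ)) : Set (ℕ × ℕ))),
      boxContent y = boxContent x + k →
      (boxGraph.induce ((κ'.cells \ κ.cells : Finset (ℕ × ℕ)) : Set (ℕ × ℕ))).Reachable x y := by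
    intro k
    induction k with
    | zero =>
      intro x y hxy
      have : x = y := Subtype.ext (h.injOn_boxContent x.2 y.2 (by simpa using hxy.symm))
      rw [this]
    | succ k ih =>
      intro x y hxy
      obtain ⟨⟨i, j⟩, hx⟩ := x
      obtain ⟨⟨i', j'⟩, hy⟩ := y
      have hx' := h.mem_sdiff_cells.1 (Finset.mem_coe.1 hx)
      have hy' := h.mem_sdiff_cells.1 (Finset.mem_coe.1 hy)
      simp only [boxContent] at hxy
      push_cast at hxy
      have h4 := le_rowCount κ ((i : ℤ) - j + 1)
      rcases rowCount_succ κ ((i : ℤ) - j) with h3 | h3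
      · have hz : (i, j - 1) ∈ κ'.cells \ κ.cells := by
          rw [h.mem_sdiff_cells, show (i : ℤ) - ((j - 1 : ℕ) : ℤ) = (i : ℤ) - j + 1 by omega]
          omega
        refine SimpleGraph.Reachable.trans (SimpleGraph.Adj.reachable ?_)
          (ih ⟨(i, j - 1), hz⟩ ⟨(i', j'), hy⟩ ?_)
        · simp only [boxGraph, SimpleGraph.comap_adj, Function.Embedding.subtype_apply,
            SimpleGraph.boxProd_adj, SimpleGraph.hasse_adj, Order.covBy_iff_add_one_eq]
          right
          refine ⟨Or.inr ?_, trivial⟩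
          omega
        · simp only [boxContent]
          omega
      · have hz : (i + 1, j) ∈ κ'.cells \ κ.cells := by
          rw [h.mem_sdiff_cells,
            show ((i + 1 : ℕ) : ℤ) - (j : ℤ) = (i : ℤ) - j + 1 by push_cast; ring]
          omega
        refine SimpleGraph.Reachable.trans (SimpleGraph.Adj.reachable ?_)
          (ih ⟨(i + 1, j), hz⟩ ⟨(i', j'), hy⟩ ?_)
        · simp only [boxGraph, SimpleGraph.comap_adj, Function.Embedding.subtype_apply,
            SimpleGraph.boxProd_adj, SimpleGraph.hasse_adj, Order.covBy_iff_add_one_eq]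
          left
          refine ⟨Or.inl ?_, ?_⟩ <;> simp
        · simp only [boxContent]
          push_cast
          omega
  obtain ⟨b, hb⟩ := hne
  have : Nonempty ((κ'.cells \ κ.cells : Finset (ℕ × ℕ)) : Set (ℕ × ℕ)) := ⟨⟨b, hb⟩⟩
  refine ⟨fun x y => ?_⟩
  rcases le_total (boxContent x) (boxContent y) with h1 | h1
  · exact key (boxContent y - boxContent x).toNat x y (by omega)
  · exact (key (boxContent x - boxContent y).toNat y x (by omega)).symm

theorem isRibbon (h : RibbonStep m κ κ' a) (hm : 0 < m) : IsRibbon m (κ'.cells \ κ.cells) where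
  skew := ⟨κ, κ', h.le, rfl⟩
  area := h.card_sdiff
  connected := h.connected hm
  no_square := by
    rintro ⟨i, j, h1, -, -, h2⟩
    have := h.injOn_boxContent h1 h2 (by simp [boxContent])
    simp at this

theorem ribbonContent_eq (h : RibbonStep m κ κ' a) (hm : 0 < m) :
    ribbonContent (κ'.cells \ κ.cells) = a - 1 := by
  have h1 : boxContent '' ((κ'.cells \ κ.cells : Finset (ℕ × ℕ)) : Set (ℕ × ℕ)) =
      Set.Ico (a - m) a := by
    rw [← Finset.coe_image, h.image_boxContent, Finset.coe_Ico]
  rw [ribbonContent, h1]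
  refine IsGreatest.csSup_eq ⟨?_, ?_⟩
  · simp only [Set.mem_Ico]
    omega
  · intro x hx
    simp only [Set.mem_Ico] at hx
    omega

/-- The Maya set marks the places where `rowCount` jumps. Adding 1 on `[a - m, a)` creates a jump at
`a - m` and removes one at `a`; since all jumps are 0 or 1, the first place was free and the second
occupied. -/
theorem mem_mayaSet_iff (h : RibbonStep m κ κ' a) (hm : 0 < m) :
    a ∈ mayaSet κ ∧ a - m ∉ mayaSet κ ∧
      ∀ x, x ∈ mayaSet κ' ↔ x = a - m ∨ (x ∈ mayaSet κ ∧ x ≠ a) := by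
  have ha := rowCount_succ κ' (a - 1)
  have ha1 := rowCount_succ κ (a - 1)
  have hb := rowCount_succ κ' (a - m - 1)
  have hb1 := rowCount_succ κ (a - m - 1)
  simp only [h _] at ha hb
  simp only [sub_add_cancel] at ha ha1 hb hb1
  rw [if_neg (by omega), if_pos (by omega)] at ha
  rw [if_pos (by omega), if_neg (by omega)] at hb
  simp only [RatShuffle.mem_mayaSet_iff, h _]
  refine ⟨by omega, by omega, fun x => ?_⟩
  have hx := rowCount_succ κ (x - 1)
  rw [sub_add_cancel] at hx
  rcases eq_or_ne x a with rfl | h1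
  · rw [if_neg (by omega), if_pos (by omega)]
    omega
  rcases eq_or_ne x (a - m) with rfl | h2
  · rw [if_pos (by omega), if_neg (by omega)]
    omega
  · by_cases h3 : a - m ≤ x ∧ x < a
    · rw [if_pos h3, if_pos (by omega)]
      omega
    · rw [if_neg h3, if_neg (by omega)]
      omega

-- A row meets the ribbon iff its Maya entry lies in `(a - m, a]`. The entry `a` always occurs and
-- accounts for the minus one in the spin.
open Classical in
theorem ribbonSpin_eq (h : RibbonStep m κ κ' a) (hm : 0 < m) :
    ribbonSpin (κ'.cells \ κ.cells) =
      ((Finset.Ioo (a - m) a).filter (· ∈ mayaSet κ)).card := by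
  have h1 : ((κ'.cells \ κ.cells).image Prod.fst).image (rowEntry κ) =
      insert a ((Finset.Ioo (a - m) a).filter (· ∈ mayaSet κ)) := by
    ext x
    simp only [Finset.mem_image, Finset.mem_insert, Finset.mem_filter, Finset.mem_Ioo,
      Prod.exists, exists_and_right, exists_eq_right]
    constructor
    · rintro ⟨i, ⟨j, hij⟩, rfl⟩
      have h2 : (i, κ.rowLen i) ∈ κ'.cells \ κ.cells := by
        rw [Finset.mem_sdiff, YoungDiagram.mem_cells, YoungDiagram.mem_cells] at hij ⊢
        rw [YoungDiagram.mem_iff_lt_rowLen (μ := κ), not_lt] at hij ⊢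
        exact ⟨κ'.up_left_mem le_rfl hij.2 hij.1, le_rfl⟩
      rw [h.mem_sdiff_cells] at h2
      have h3 : rowEntry κ i = (i : ℤ) - κ.rowLen i + 1 := by rw [rowEntry]; ring
      rcases eq_or_ne (rowEntry κ i) a with h4 | h4
      · exact Or.inl h4
      · exact Or.inr ⟨by omega, mem_mayaSet.2 ⟨i, rfl⟩⟩
    · intro hx
      have h2 : x ∈ mayaSet κ ∧ a - m < x ∧ x ≤ a := by
        rcases hx with rfl | hx
        · exact ⟨(h.mem_mayaSet_iff hm).1, by omega, le_rfl⟩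
        · exact ⟨hx.2, hx.1.1, hx.1.2.le⟩
      obtain ⟨hM, hx1, hx2⟩ := h2
      obtain ⟨i, rfl⟩ := mem_mayaSet.1 hM
      refine ⟨i, ⟨κ.rowLen i, ?_⟩, rfl⟩
      have h3 : (i : ℤ) - κ.rowLen i = rowEntry κ i - 1 := by rw [rowEntry]; ring
      rw [h.mem_sdiff_cells, h3, rowCount_rowEntry_sub_one]
      omega
  have h2 := congrArg Finset.card h1
  rw [Finset.card_image_of_injective _ (rowEntry_strictMono κ).injective,
    Finset.card_insert_of_notMem (by simp)] at h2
  rw [ribbonSpin, ribbonHeight, h2]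
  rfl

end RibbonStep

theorem exists_ribbonStep {m : ℕ} {κ : YoungDiagram} {a : ℤ} (hm : 0 < m) (ha : a ∈ mayaSet κ)
    (hb : a - m ∉ mayaSet κ) : ∃ κ', RibbonStep m κ κ' a := by
  have h1 := rowCount_of_mem ha
  have h2 := rowCount_of_notMem hb
  refine exists_diagram_rowCount
    (R := fun c => rowCount κ c + if a - m ≤ c ∧ c < a then 1 else 0)
    (K := κ.colLen 0 + a.natAbs + m + (rowEntry κ 0).natAbs + 1) ?_ ?_ ?_
  · intro c
    rcases eq_or_ne (c + 1) a with rfl | h3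
    · rw [add_sub_cancel_right] at h1
      rw [if_neg (by omega), if_pos (by omega)]
      omega
    rcases eq_or_ne (c + 1) (a - m) with h4 | h4
    · rw [← h4, add_sub_cancel_right] at h2
      rw [if_pos (by omega), if_neg (by omega)]
      omega
    · have := rowCount_succ κ c
      by_cases h5 : a - m ≤ c ∧ c < a
      · rw [if_pos h5, if_pos (by omega)]
        omega
      · rw [if_neg h5, if_neg (by omega)]
        omega
  · intro c hc
    rw [if_neg (by omega), rowCount_eq_zero (by omega)]
  · intro c hc
    rw [if_neg (by omega)]
    exact rowCount_eq_self (by omega)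

theorem exists_Ico_of_ordConnected {m : ℕ} (hm : 0 < m) {C : Finset ℤ} (hcard : C.card = m)
    (hC : ∀ x ∈ C, ∀ y ∈ C, ∀ z, x ≤ z → z ≤ y → z ∈ C) : ∃ a : ℤ, C = Finset.Ico (a - m) a := by
  have hne : C.Nonempty := by rw [← Finset.card_pos]; omega
  have h1 : C = Finset.Ico (C.min' hne) (C.max' hne + 1) := by
    ext x
    rw [Finset.mem_Ico]
    exact ⟨fun h => ⟨C.min'_le _ h, by have := C.le_max' _ h; omega⟩,
      fun h => hC _ (C.min'_mem hne) _ (C.max'_mem hne) _ h.1 (by omega)⟩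
  refine ⟨C.max' hne + 1, ?_⟩
  have h2 := congrArg Finset.card h1
  rw [hcard, Int.card_Ico] at h2
  rw [show C.max' hne + 1 - m = C.min' hne by omega]
  exact h1

/-- Contents of adjacent boxes differ by one, so a path in `r` cannot jump over `z`. -/
theorem boxContent_mem_of_connected {r : Finset (ℕ × ℕ)}
    (hr : (boxGraph.induce (r : Set (ℕ × ℕ))).Connected) {x y : ℕ × ℕ} (hx : x ∈ r) (hy : y ∈ r)
    {z : ℤ} (h1 : boxContent x ≤ z) (h2 : z ≤ boxContent y) : z ∈ r.image boxContent := by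
  by_contra hz
  have hne : ∀ b ∈ r, boxContent b ≠ z := fun b hb h => hz (Finset.mem_image.2 ⟨b, hb, h⟩)
  have h3 := hr.preconnected ⟨x, hx⟩ ⟨y, hy⟩
  rw [SimpleGraph.reachable_iff_reflTransGen] at h3
  have h4 : ∀ b : (r : Set (ℕ × ℕ)), Relation.ReflTransGen
      (boxGraph.induce (r : Set (ℕ × ℕ))).Adj ⟨x, hx⟩ b → boxContent b < z := by
    intro b hb
    induction hb with
    | refl => exact lt_of_le_of_ne h1 (hne x hx)
    | @tail b c _ hbc ih =>
      have hb := hne c c.2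
      obtain ⟨⟨i, j⟩, hb1⟩ := b
      obtain ⟨⟨i', j'⟩, hc1⟩ := c
      simp only [boxGraph, SimpleGraph.comap_adj, Function.Embedding.subtype_apply,
        SimpleGraph.boxProd_adj, SimpleGraph.hasse_adj, Order.covBy_iff_add_one_eq] at hbc
      simp only [boxContent] at ih hb ⊢
      omega
  have := h4 _ h3
  simp only at this
  omega

/-- Two boxes on one diagonal would force a 2 × 2 square, the other two corners being present
because the shape is skew. So each content occurs at most once, and by connectedness the `m`
contents form an interval. -/
theorem IsRibbon.exists_ribbonStep {m : ℕ} {κ κ' : YoungDiagram} (hm : 0 < m) (hle : κ ≤ κ')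
    (h : IsRibbon m (κ'.cells \ κ.cells)) : ∃ a, RibbonStep m κ κ' a := by
  have hle' := le_iff_rowCount_le.1 hle
  have h1 : ∀ c, rowCount κ' c ≤ rowCount κ c + 1 := by
    intro c
    by_contra! h2
    have h3 := le_rowCount κ c
    apply h.no_square
    have e : (rowCount κ c : ℤ) - ((rowCount κ c - c).toNat : ℤ) = c := by omega
    have b1 : (rowCount κ c, (rowCount κ c - c).toNat) ∈ κ'.cells \ κ.cells := by
      rw [mem_sdiff_cells, e]
      omega
    have b2 : (rowCount κ c + 1, (rowCount κ c - c).toNat + 1) ∈ κ'.cells \ κ.cells := by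
      rw [mem_sdiff_cells]
      push_cast
      rw [add_sub_add_right_eq_sub, e]
      omega
    refine ⟨_, _, b1, ?_, ?_, b2⟩
    · rw [Finset.mem_sdiff, YoungDiagram.mem_cells, YoungDiagram.mem_cells] at b1 b2 ⊢
      exact ⟨κ'.up_left_mem le_rfl (Nat.le_succ _) b2.1,
        fun hb => b1.2 (κ.up_left_mem (Nat.le_succ _) le_rfl hb)⟩
    · rw [Finset.mem_sdiff, YoungDiagram.mem_cells, YoungDiagram.mem_cells] at b1 b2 ⊢
      exact ⟨κ'.up_left_mem (Nat.le_succ _) le_rfl b2.1,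
        fun hb => b1.2 (κ.up_left_mem le_rfl (Nat.le_succ _) hb)⟩
  have hinj : Set.InjOn boxContent (κ'.cells \ κ.cells : Finset (ℕ × ℕ)) := by
    rintro ⟨i, j⟩ h2 ⟨i', j'⟩ h3 h4
    rw [Finset.mem_coe, mem_sdiff_cells] at h2 h3
    simp only [boxContent] at h4
    rw [h4] at h2
    have h5 := h1 ((i' : ℤ) - j')
    have : i = i' := by omega
    subst this
    have : j = j' := by omega
    subst this
    rfl
  have hcard : ((κ'.cells \ κ.cells).image boxContent).card = m := by
    rw [Finset.card_image_of_injOn hinj, h.area]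
  obtain ⟨a, ha⟩ := exists_Ico_of_ordConnected hm hcard (by
    intro x hx y hy z hxz hzy
    obtain ⟨bx, hbx, rfl⟩ := Finset.mem_image.1 hx
    obtain ⟨b', hb', rfl⟩ := Finset.mem_image.1 hy
    exact boxContent_mem_of_connected h.connected hbx hb' hxz hzy)
  refine ⟨a, fun c => ?_⟩
  have h2 : c ∈ Finset.Ico (a - m) a ↔ rowCount κ c < rowCount κ' c := by
    rw [← ha, Finset.mem_image]
    constructor
    · rintro ⟨⟨i, j⟩, hij, rfl⟩
      rw [mem_sdiff_cells] at hij
      simp only [boxContent]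
      omega
    · intro h3
      have h4 := le_rowCount κ c
      have e : (rowCount κ c : ℤ) - ((rowCount κ c - c).toNat : ℤ) = c := by omega
      refine ⟨(rowCount κ c, (rowCount κ c - c).toNat), ?_, e⟩
      rw [mem_sdiff_cells, e]
      omega
  rw [Finset.mem_Ico] at h2
  have h3 := h1 c
  have h4 := hle' c
  split_ifs with h5
  · have := h2.1 h5
    omega
  · have : ¬ rowCount κ c < rowCount κ' c := fun h6 => h5 (h2.2 h6)
    omega

/-! ### Cores -/

/-- The Maya entry of row `i` plus the hook length of `(i, j)` is `colLen j - j`, the place of a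
horizontal boundary step, which is never in the Maya set. -/
theorem isCore_of_add_mem {m : ℕ} {κ : YoungDiagram}
    (h : ∀ x ∈ mayaSet κ, x + m ∈ mayaSet κ) : IsCore m κ := by
  rintro ⟨i, j⟩ hc hhook
  have h1 : j < κ.rowLen i := YoungDiagram.mem_iff_lt_rowLen.1 hc
  have h2 : i < κ.colLen j := YoungDiagram.mem_iff_lt_colLen.1 hc
  have h3 : hookLength κ (i, j) = (κ.rowLen i - j) + (κ.colLen j - i - 1) := by
    have e : κ.cells.filter (fun b => (b.1 = i ∧ j ≤ b.2) ∨ (b.2 = j ∧ i < b.1)) =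
        (({i} : Finset ℕ) ×ˢ Finset.Ico j (κ.rowLen i)) ∪
          (Finset.Ioo i (κ.colLen j) ×ˢ ({j} : Finset ℕ)) := by
      ext ⟨i', j'⟩
      simp only [Finset.mem_filter, YoungDiagram.mem_cells, Finset.mem_union, Finset.mem_product,
        Finset.mem_singleton, Finset.mem_Ico, Finset.mem_Ioo]
      constructor
      · rintro ⟨hb, ⟨rfl, hj⟩ | ⟨rfl, hi⟩⟩
        · exact Or.inl ⟨rfl, hj, YoungDiagram.mem_iff_lt_rowLen.1 hb⟩
        · exact Or.inr ⟨⟨hi, YoungDiagram.mem_iff_lt_colLen.1 hb⟩, rfl⟩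
      · rintro (⟨rfl, hj, hb⟩ | ⟨⟨hi, hb⟩, rfl⟩)
        · exact ⟨YoungDiagram.mem_iff_lt_rowLen.2 hb, Or.inl ⟨rfl, hj⟩⟩
        · exact ⟨YoungDiagram.mem_iff_lt_colLen.2 hb, Or.inr ⟨rfl, hi⟩⟩
    rw [hookLength, e, Finset.card_union_of_disjoint, Finset.card_product, Finset.card_product]
    · simp
    · rw [Finset.disjoint_left]
      rintro ⟨i', j'⟩ hb hb'
      simp only [Finset.mem_product, Finset.mem_singleton, Finset.mem_Ico, Finset.mem_Ioo]
        at hb hb'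
      omega
  rw [h3] at hhook
  obtain ⟨k, hk⟩ := mem_mayaSet.1 (h _ (mem_mayaSet.2 ⟨i, rfl⟩))
  rw [rowEntry, rowEntry] at hk
  have h4 : (k, j) ∈ κ ↔ j < κ.rowLen k := YoungDiagram.mem_iff_lt_rowLen
  rw [YoungDiagram.mem_iff_lt_colLen] at h4
  omega

/-! ### Complete residue systems and affine permutations -/

/-- The integers `A i` are pairwise incongruent modulo `n`, hence a complete residue system. -/
def IsResidueSystem {n : ℕ} (A : Fin n → ℤ) : Prop :=
  ∀ i j, (n : ℤ) ∣ A i - A j → i = j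

theorem IsResidueSystem.sub_const {n : ℕ} {A : Fin n → ℤ} (hA : IsResidueSystem A) (d : ℤ) :
    IsResidueSystem fun i => A i - d := fun i j h => hA i j (by simpa using h)

theorem isResidueSystem_succ (n : ℕ) : IsResidueSystem fun i : Fin n => (i : ℤ) + 1 := by
  intro i j h
  have h1 : (n : ℤ) ∣ (i : ℤ) - j := by simpa using h
  have h2 := Int.eq_zero_of_abs_lt_dvd h1 (by rw [abs_lt]; omega)
  apply Fin.ext
  omega

theorem IsResidueSystem.bijective_cast {n : ℕ} [NeZero n] {A : Fin n → ℤ}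
    (hA : IsResidueSystem A) : Function.Bijective fun i => (A i : ZMod n) := by
  rw [Fintype.bijective_iff_injective_and_card]
  refine ⟨fun i j h => hA i j ?_, by simp [ZMod.card]⟩
  rw [← ZMod.intCast_zmod_eq_zero_iff_dvd]
  simp only at h
  push_cast
  rw [h, sub_self]

theorem IsResidueSystem.exists_eq_add {n : ℕ} [NeZero n] {A : Fin n → ℤ}
    (hA : IsResidueSystem A) (x : ℤ) : ∃ (i : Fin n) (q : ℤ), x = A i + n * q := by
  obtain ⟨i, hi⟩ := hA.bijective_cast.2 (x : ZMod n)
  simp only at hi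
  have h1 : (n : ℤ) ∣ x - A i := by
    rw [← ZMod.intCast_zmod_eq_zero_iff_dvd]
    push_cast
    rw [hi, sub_self]
  obtain ⟨q, hq⟩ := h1
  exact ⟨i, q, by rw [← hq]; ring⟩

theorem IsResidueSystem.eq_of_add_eq {n : ℕ} [NeZero n] {A : Fin n → ℤ}
    (hA : IsResidueSystem A) {i j : Fin n} {q r : ℤ} (h : A i + n * q = A j + n * r) :
    i = j ∧ q = r := by
  have h1 : i = j := hA i j ⟨r - q, by linarith⟩
  subst h1
  refine ⟨rfl, ?_⟩
  have h2 : (n : ℤ) ≠ 0 := by exact_mod_cast NeZero.ne n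
  exact mul_left_cancel₀ h2 (by linarith)

theorem IsResidueSystem.injective {n : ℕ} {A : Fin n → ℤ}
    (hA : IsResidueSystem A) : Function.Injective A :=
  fun i j h => hA i j (by rw [h, sub_self]; exact dvd_zero _)

/-- Every integer is `A i + n q` for a unique pair `(i, q)`. -/
def IsResidueSystem.equiv {n : ℕ} [NeZero n] {A : Fin n → ℤ} (hA : IsResidueSystem A) :
    Fin n × ℤ ≃ ℤ :=
  Equiv.ofBijective (fun p => A p.1 + n * p.2)
    ⟨fun _ _ h => Prod.ext (hA.eq_of_add_eq h).1 (hA.eq_of_add_eq h).2,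
      fun x => let ⟨i, q, h⟩ := hA.exists_eq_add x; ⟨(i, q), h.symm⟩⟩

theorem IsResidueSystem.sum_eq_sum_zmod {n : ℕ} [NeZero n] {M : Type*} [AddCommMonoid M]
    {A : Fin n → ℤ} (hA : IsResidueSystem A) {g : ℤ → M} (hg : Function.Periodic g n) :
    ∑ i, g (A i) = ∑ z : ZMod n, g z.val := by
  refine Fintype.sum_bijective _ hA.bijective_cast _ _ fun i => ?_
  rw [ZMod.val_intCast, Int.emod_def, mul_comm]
  exact (hg.sub_int_mul_eq _).symm

theorem sum_Icc_eq_sum_fin {n : ℕ} {M : Type*} [AddCommMonoid M] (g : ℤ → M) :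
    ∑ x ∈ Finset.Icc (1 : ℤ) n, g x = ∑ i : Fin n, g ((i : ℤ) + 1) := by
  symm
  refine Finset.sum_nbij (fun i : Fin n => (i : ℤ) + 1) ?_ ?_ ?_ fun _ _ => rfl
  · intro i _
    rw [Finset.mem_Icc]
    omega
  · intro i _ j _ h
    simp only at h
    apply Fin.ext
    omega
  · intro x hx
    rw [Finset.mem_coe, Finset.mem_Icc] at hx
    refine ⟨⟨(x - 1).toNat, by omega⟩, Finset.mem_coe.2 (Finset.mem_univ _), ?_⟩
    simp only
    omega

/-- Moves periodic sums from the window `1, ..., n`, in which inversions and the normalisation are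
defined, to the generators. -/
theorem IsResidueSystem.sum_eq_sum_Icc {n : ℕ} [NeZero n] {M : Type*} [AddCommMonoid M]
    {A : Fin n → ℤ} (hA : IsResidueSystem A) {g : ℤ → M} (hg : Function.Periodic g n) :
    ∑ i, g (A i) = ∑ x ∈ Finset.Icc (1 : ℤ) n, g x := by
  rw [sum_Icc_eq_sum_fin, hA.sum_eq_sum_zmod hg, (isResidueSystem_succ n).sum_eq_sum_zmod hg]

theorem sum_fin_add_one (n : ℕ) : ∑ i : Fin n, ((i : ℤ) + 1) = (n : ℤ) * (n + 1) / 2 := by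
  have h : ∀ n : ℕ, (∑ i : Fin n, ((i : ℤ) + 1)) * 2 = (n : ℤ) * (n + 1) := by
    intro n
    induction n with
    | zero => simp
    | succ n ih =>
      rw [Fin.sum_univ_castSucc, add_mul]
      simp only [Fin.val_castSucc, Fin.val_last]
      rw [ih]
      push_cast
      ring
  rw [← h n]
  simp

/-- A bijection of `ℤ` that commutes with the translation by `n`. -/
def IsAffine (n : ℕ) (ω : Equiv.Perm ℤ) : Prop := ∀ x, ω (x + n) = ω x + n

theorem IsAffine.apply_add_mul {n : ℕ} {ω : Equiv.Perm ℤ} (h : IsAffine n ω) (x q : ℤ) :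
    ω (x + n * q) = ω x + n * q := by
  induction q using Int.induction_on with
  | zero => simp
  | succ k ih =>
    rw [mul_add, mul_one, ← add_assoc, h, ih, add_assoc]
  | pred k ih =>
    have := h (x + n * (-k - 1))
    rw [show x + n * (-(k : ℤ) - 1) + n = x + n * (-(k : ℤ)) by ring, ih] at this
    linarith

theorem IsAffine.periodic_sub {n : ℕ} {ω : Equiv.Perm ℤ} (h : IsAffine n ω) :
    Function.Periodic (fun x => ω x - x) (n : ℤ) := by
  intro x
  simp only [h x]
  ring

/-- Since `ω x - x` is periodic, the defect from the normalisation is the same on every residue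
system. -/
theorem IsAffine.sum_residueSystem {n : ℕ} [NeZero n] {ω : Equiv.Perm ℤ} (h : IsAffine n ω)
    {A : Fin n → ℤ} (hA : IsResidueSystem A) :
    ∑ i, ω (A i) - ∑ i, A i =
      ∑ x ∈ Finset.Icc (1 : ℤ) n, ω x - (n : ℤ) * (n + 1) / 2 := by
  have h1 := hA.sum_eq_sum_Icc h.periodic_sub
  rw [Finset.sum_sub_distrib, Finset.sum_sub_distrib] at h1
  rw [h1, sum_Icc_eq_sum_fin (fun x => x), sum_fin_add_one]

/-- The affine permutation that maps `A i` to `e i + 1`, where `A` is a residue system. -/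
def IsResidueSystem.affinePerm {n : ℕ} [NeZero n] {A : Fin n → ℤ} (hA : IsResidueSystem A)
    (e : Equiv.Perm (Fin n)) : Equiv.Perm ℤ :=
  hA.equiv.symm.trans ((e.prodCongr (Equiv.refl ℤ)).trans (isResidueSystem_succ n).equiv)

theorem IsResidueSystem.affinePerm_add_mul {n : ℕ} [NeZero n] {A : Fin n → ℤ}
    (hA : IsResidueSystem A) (e : Equiv.Perm (Fin n)) (i : Fin n) (q : ℤ) :
    hA.affinePerm e (A i + n * q) = (e i : ℤ) + 1 + n * q := by
  have h : A i + n * q = hA.equiv (i, q) := rfl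
  rw [h, affinePerm, Equiv.trans_apply, Equiv.symm_apply_apply]
  rfl

theorem IsResidueSystem.affinePerm_apply {n : ℕ} [NeZero n] {A : Fin n → ℤ}
    (hA : IsResidueSystem A) (e : Equiv.Perm (Fin n)) (i : Fin n) :
    hA.affinePerm e (A i) = (e i : ℤ) + 1 := by
  simpa using hA.affinePerm_add_mul e i 0

theorem IsResidueSystem.isAffine_affinePerm {n : ℕ} [NeZero n] {A : Fin n → ℤ}
    (hA : IsResidueSystem A) (e : Equiv.Perm (Fin n)) : IsAffine n (hA.affinePerm e) := by
  intro x
  obtain ⟨i, q, rfl⟩ := hA.exists_eq_add x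
  rw [show A i + n * q + n = A i + n * (q + 1) by ring, hA.affinePerm_add_mul,
    hA.affinePerm_add_mul]
  ring

theorem IsResidueSystem.eq_affinePerm {n : ℕ} [NeZero n] {A : Fin n → ℤ}
    (hA : IsResidueSystem A) {e : Equiv.Perm (Fin n)} {ω : Equiv.Perm ℤ} (hω : IsAffine n ω)
    (h : ∀ i, ω (A i) = (e i : ℤ) + 1) : ω = hA.affinePerm e := by
  ext x
  obtain ⟨i, q, rfl⟩ := hA.exists_eq_add x
  rw [hω.apply_add_mul, hA.affinePerm_add_mul, h]

theorem IsResidueSystem.affinePerm_symm_apply {n : ℕ} [NeZero n] {A : Fin n → ℤ}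
    (hA : IsResidueSystem A) (e : Equiv.Perm (Fin n)) (k : Fin n) :
    (hA.affinePerm e).symm ((k : ℤ) + 1) = A (e.symm k) := by
  rw [Equiv.symm_apply_eq, hA.affinePerm_apply, Equiv.apply_symm_apply]

/-- The set of all `A i + n k` with `k ≥ 0`. -/
def generatedSet {n : ℕ} (A : Fin n → ℤ) : Set ℤ := {x | ∃ (i : Fin n) (k : ℕ), x = A i + n * k}

theorem IsResidueSystem.add_mul_mem_iff {n : ℕ} [NeZero n] {A : Fin n → ℤ}
    (hA : IsResidueSystem A) {i : Fin n} {q : ℤ} : A i + n * q ∈ generatedSet A ↔ 0 ≤ q := by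
  constructor
  · rintro ⟨j, k, h⟩
    have := (hA.eq_of_add_eq h).2
    omega
  · intro h
    refine ⟨i, q.toNat, ?_⟩
    rw [Int.toNat_of_nonneg h]

theorem mem_generatedSet {n : ℕ} (A : Fin n → ℤ) (i : Fin n) : A i ∈ generatedSet A :=
  ⟨i, 0, by simp⟩

theorem IsResidueSystem.positiveSet_affinePerm {n : ℕ} [NeZero n] {A : Fin n → ℤ}
    (hA : IsResidueSystem A) (e : Equiv.Perm (Fin n)) :
    positiveSet (hA.affinePerm e) = generatedSet A := by
  ext x
  obtain ⟨i, q, rfl⟩ := hA.exists_eq_add x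
  rw [hA.add_mul_mem_iff, positiveSet, Set.mem_ofPred_eq, hA.affinePerm_add_mul]
  have h1 := (e i).isLt
  have h0 : 0 < (n : ℤ) := by omega
  constructor
  · intro h
    by_contra! h2
    have h3 : (n : ℤ) * q ≤ n * (-1) := mul_le_mul_of_nonneg_left (by omega) h0.le
    omega
  · intro h
    have h3 : 0 ≤ (n : ℤ) * q := mul_nonneg h0.le h
    omega

/-- If `A j - m = A i + n k`, then `A j` exceeds the element `A i + m` of the set by `n k`; a
generator is minimal in its class, so `k = 0`. -/
theorem IsResidueSystem.eq_of_add_eq_mem {n : ℕ} [NeZero n] {A : Fin n → ℤ}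
    (hA : IsResidueSystem A) {m : ℕ} (hm : ∀ x ∈ generatedSet A, x + m ∈ generatedSet A)
    {j : Fin n} (h : A j - m ∈ generatedSet A) : ∃ i, A j = A i + m := by
  obtain ⟨i, k, hk⟩ := h
  obtain ⟨l, r, hr⟩ := hm _ (mem_generatedSet A i)
  have h1 : A j + n * 0 = A l + n * (r + k : ℤ) := by linarith
  obtain ⟨-, h2⟩ := hA.eq_of_add_eq h1
  have h3 : k = 0 := by omega
  subst h3
  exact ⟨i, by simp at hk; linarith⟩

/-- The permutation `e` of the generators respects the order in every progression of
difference `m`. -/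
def IsAdmissible (m : ℕ) {n : ℕ} (A : Fin n → ℤ) (e : Equiv.Perm (Fin n)) : Prop :=
  ∀ i j, A j = A i + m → e i < e j

/-- Adding `m` to `A i` gives `A j + n k` with `k ≥ 0`. For `k > 0` the value grows because labels
differ by less than `n`; only `k = 0` needs admissibility. -/
theorem IsResidueSystem.isStable_affinePerm {n : ℕ} [NeZero n] {A : Fin n → ℤ}
    (hA : IsResidueSystem A) (hsum : ∑ i, A i = (n : ℤ) * (n + 1) / 2) {m : ℕ}
    (hm : ∀ x ∈ generatedSet A, x + m ∈ generatedSet A) {e : Equiv.Perm (Fin n)}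
    (he : IsAdmissible m A e) : IsStable m n (hA.affinePerm e) := by
  refine ⟨hA.isAffine_affinePerm e, ?_, fun x => ?_⟩
  · have h1 := (hA.isAffine_affinePerm e).sum_residueSystem hA
    simp only [hA.affinePerm_apply] at h1
    rw [Equiv.sum_comp e (fun i : Fin n => (i : ℤ) + 1), sum_fin_add_one] at h1
    linarith
  · obtain ⟨i, q, rfl⟩ := hA.exists_eq_add x
    obtain ⟨j, k, hk⟩ := hm _ (mem_generatedSet A i)
    rw [show A i + n * q + m = A j + n * (k + q) by linarith, hA.affinePerm_add_mul,
      hA.affinePerm_add_mul, mul_add]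
    rcases Nat.eq_zero_or_pos k with rfl | h
    · have := he i j (by simp at hk; linarith)
      rw [Fin.lt_def] at this
      simp only [Nat.cast_zero, mul_zero]
      omega
    · have h1 : (n : ℤ) * 1 ≤ n * k := by gcongr; omega
      have := (e i).isLt
      omega

/-- `A i` lies in Δ_ω and `A i - n` does not, so `ω (A i)` lies in `1, ..., n` and ω only orders the
generators. -/
theorem IsStable.exists_eq_affinePerm {m n : ℕ} [NeZero n] {A : Fin n → ℤ} {ω : Equiv.Perm ℤ}
    (hω : IsStable m n ω) (hA : IsResidueSystem A) (h : positiveSet ω = generatedSet A) :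
    ∃ e, IsAdmissible m A e ∧ ω = hA.affinePerm e := by
  have h1 : ∀ i, 0 < ω (A i) ∧ ω (A i) ≤ n := by
    intro i
    have h2 : A i ∈ positiveSet ω := by rw [h]; exact mem_generatedSet A i
    have h3 : A i + n * (-1) ∉ positiveSet ω := by
      rw [h, hA.add_mul_mem_iff]
      omega
    rw [positiveSet, Set.mem_ofPred_eq] at h2 h3
    rw [IsAffine.apply_add_mul hω.1] at h3
    omega
  let f : Fin n → Fin n := fun i => ⟨(ω (A i) - 1).toNat, by have := h1 i; omega⟩
  have hf : ∀ i, ω (A i) = (f i : ℤ) + 1 := by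
    intro i
    have := h1 i
    simp only [f]
    omega
  have hinj : Function.Injective f := by
    intro i j hij
    apply hA.injective
    apply ω.injective
    rw [hf, hf, hij]
  refine ⟨Equiv.ofBijective f (Finite.injective_iff_bijective.1 hinj), ?_, ?_⟩
  · intro i j hij
    have h2 := hω.2.2 (A i)
    rw [← hij, hf, hf] at h2
    simp only [Equiv.ofBijective_apply]
    rw [Fin.lt_def]
    omega
  · exact hA.eq_affinePerm hω.1 hf

theorem isAdmissible_sort {m n : ℕ} {A : Fin n → ℤ} (hm : 0 < m) :
    IsAdmissible m A (Tuple.sort A).symm := by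
  intro i j h
  by_contra! h1
  have h2 := Tuple.monotone_sort A h1
  simp at h2
  omega

/-- The inverse of ω at `k + 1` is `A (e.symm k)`, so it increases exactly when `e.symm` sorts the
generators. -/
theorem existsUnique_isIncreasingStable {m n : ℕ} [NeZero n] (hm0 : 0 < m) {A : Fin n → ℤ}
    (hA : IsResidueSystem A) (hsum : ∑ i, A i = (n : ℤ) * (n + 1) / 2)
    (hm : ∀ x ∈ generatedSet A, x + m ∈ generatedSet A) :
    IsIncreasingStable m n (generatedSet A) (hA.affinePerm (Tuple.sort A).symm) ∧
      ∀ ω, IsIncreasingStable m n (generatedSet A) ω →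
        ω = hA.affinePerm (Tuple.sort A).symm := by
  refine ⟨⟨hA.isStable_affinePerm hsum hm (isAdmissible_sort hm0),
    hA.positiveSet_affinePerm _, ?_⟩, ?_⟩
  · simp only [hA.affinePerm_symm_apply, Equiv.symm_symm]
    exact (Tuple.monotone_sort A).strictMono_of_injective
      (hA.injective.comp (Tuple.sort A).injective)
  · rintro ω ⟨hω, hpos, hmono⟩
    obtain ⟨e, -, rfl⟩ := hω.exists_eq_affinePerm hA hpos
    simp only [hA.affinePerm_symm_apply] at hmono
    have h1 : e.symm = Tuple.sort A := by
      rw [Tuple.eq_sort_iff]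
      refine ⟨hmono.monotone, fun i j hij h => absurd h (hmono hij).ne⟩
    rw [← h1, Equiv.symm_symm]

/-! ### Counting inversions -/

open Classical in
theorem ncard_inversions {m n : ℕ} (ω : Equiv.Perm ℤ) :
    {p : ℤ × ℤ | 1 ≤ p.1 ∧ p.1 ≤ n ∧ p.1 < p.2 ∧ p.2 < p.1 + m ∧ ω p.2 < ω p.1}.ncard =
      ∑ x ∈ Finset.Icc (1 : ℤ) n, ∑ d ∈ Finset.Ioo (0 : ℤ) m,
        if ω (x + d) < ω x then 1 else 0 := by
  rw [← Finset.sum_product', ← Finset.card_filter]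
  have h : {p : ℤ × ℤ | 1 ≤ p.1 ∧ p.1 ≤ n ∧ p.1 < p.2 ∧ p.2 < p.1 + m ∧ ω p.2 < ω p.1} =
      ((((Finset.Icc (1 : ℤ) n ×ˢ Finset.Ioo (0 : ℤ) m).filter
        fun p => ω (p.1 + p.2) < ω p.1).image fun p => (p.1, p.1 + p.2) : Finset (ℤ × ℤ)) :
          Set (ℤ × ℤ)) := by
    ext ⟨x, y⟩
    simp only [Set.mem_ofPred_eq, Finset.coe_image, Set.mem_image, Finset.mem_coe,
      Finset.mem_filter, Finset.mem_product, Finset.mem_Icc, Finset.mem_Ioo, Prod.exists,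
      Prod.mk.injEq]
    constructor
    · rintro ⟨h1, h2, h3, h4, h5⟩
      exact ⟨x, y - x, ⟨⟨⟨h1, h2⟩, by omega, by omega⟩, by rwa [add_sub_cancel]⟩, rfl, by ring⟩
    · rintro ⟨a, d, ⟨⟨⟨h1, h2⟩, h3, h4⟩, h5⟩, rfl, rfl⟩
      exact ⟨h1, h2, by omega, by omega, h5⟩
  rw [h, Set.ncard_coe_finset, Finset.card_image_of_injective]
  rintro ⟨x, d⟩ ⟨x', d'⟩ h1
  simp only [Prod.mk.injEq] at h1
  obtain ⟨rfl, h1⟩ := h1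
  simp only [Prod.mk.injEq, true_and]
  omega

open Classical in
theorem IsAffine.sum_inversions_above {m n : ℕ} [NeZero n] {ω : Equiv.Perm ℤ} (hω : IsAffine n ω)
    {A : Fin n → ℤ} (hA : IsResidueSystem A) :
    (∑ x ∈ Finset.Icc (1 : ℤ) n, ∑ d ∈ Finset.Ioo (0 : ℤ) m,
        if ω (x + d) < ω x then 1 else 0) =
      ∑ i, ∑ d ∈ Finset.Ioo (0 : ℤ) m, if ω (A i + d) < ω (A i) then 1 else 0 := by
  refine (hA.sum_eq_sum_Icc (g := fun x => ∑ d ∈ Finset.Ioo (0 : ℤ) m,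
    if ω (x + d) < ω x then 1 else 0) fun x => ?_).symm
  refine Finset.sum_congr rfl fun d _ => ?_
  rw [show x + n + d = x + d + n by ring, hω, hω]
  simp

-- Inversions of a fixed height `d` are counted here at their right ends, after shifting the residue
-- system by `d`. Comparing this count with the one at left ends yields the spin formula.
open Classical in
theorem IsAffine.sum_inversions_below {m n : ℕ} [NeZero n] {ω : Equiv.Perm ℤ} (hω : IsAffine n ω)
    {A : Fin n → ℤ} (hA : IsResidueSystem A) :
    (∑ x ∈ Finset.Icc (1 : ℤ) n, ∑ d ∈ Finset.Ioo (0 : ℤ) m,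
        if ω (x + d) < ω x then 1 else 0) =
      ∑ i, ∑ d ∈ Finset.Ioo (0 : ℤ) m, if ω (A i) < ω (A i - d) then 1 else 0 := by
  rw [Finset.sum_comm, Finset.sum_comm (s := Finset.univ)]
  refine Finset.sum_congr rfl fun d _ => ?_
  rw [← (hA.sub_const d).sum_eq_sum_Icc]
  · simp only [sub_add_cancel]
  · intro x
    simp only
    rw [show x + n + d = x + d + n by ring, hω, hω]
    simp

open Classical in
/-- The number of pairs of generators that form an inversion of height less than `m`. -/
def generatorInversions (m : ℕ) {n : ℕ} (A : Fin n → ℤ) (e : Equiv.Perm (Fin n)) : ℕ :=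
  ∑ i, ∑ d ∈ Finset.Ioo (0 : ℤ) m, if ∃ j, A j = A i + d ∧ e j < e i then 1 else 0

open Classical in
/-- The number of pairs of a generator and a larger gap at distance less than `m`. -/
def generatorGaps (m : ℕ) {n : ℕ} (A : Fin n → ℤ) : ℕ :=
  ∑ i, ∑ d ∈ Finset.Ioo (0 : ℤ) m, if A i + d ∉ generatedSet A then 1 else 0

/-- Values are at most 0 on gaps, `1, ..., n` on generators, and larger than `n` on the rest of the
set. -/
theorem IsResidueSystem.affinePerm_lt_iff {n : ℕ} [NeZero n] {A : Fin n → ℤ}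
    (hA : IsResidueSystem A) (e : Equiv.Perm (Fin n)) (i : Fin n) (x : ℤ) :
    hA.affinePerm e x < hA.affinePerm e (A i) ↔
      x ∉ generatedSet A ∨ ∃ j, A j = x ∧ e j < e i := by
  obtain ⟨j, q, rfl⟩ := hA.exists_eq_add x
  rw [hA.affinePerm_apply, hA.affinePerm_add_mul, hA.add_mul_mem_iff]
  have h1 := (e i).isLt
  have h2 := (e j).isLt
  have h0 : 0 < (n : ℤ) := by omega
  rcases lt_trichotomy q 0 with hq | rfl | hq
  · have h3 : (n : ℤ) * q ≤ n * (-1) := mul_le_mul_of_nonneg_left (by omega) h0.le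
    constructor <;> intro _ <;> omega
  · simp only [mul_zero, add_zero, le_refl, not_true_eq_false, false_or]
    constructor
    · intro h
      exact ⟨j, rfl, by rw [Fin.lt_def]; omega⟩
    · rintro ⟨l, hl, h⟩
      rw [hA.injective hl, Fin.lt_def] at h
      omega
  · have h3 : (n : ℤ) * 1 ≤ n * q := mul_le_mul_of_nonneg_left (by omega) h0.le
    constructor
    · intro h
      omega
    · rintro (h | ⟨l, hl, h⟩)
      · omega
      · have := (hA.eq_of_add_eq (q := 0) (r := q) (by rw [← hl]; ring)).2
        omega

theorem IsResidueSystem.lt_affinePerm_iff {n : ℕ} [NeZero n] {A : Fin n → ℤ}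
    (hA : IsResidueSystem A) (e : Equiv.Perm (Fin n)) (i : Fin n) {x : ℤ} (hx : x ≠ A i) :
    hA.affinePerm e (A i) < hA.affinePerm e x ↔
      x ∈ generatedSet A ∧ ¬ ∃ j, A j = x ∧ e j < e i := by
  have h1 : hA.affinePerm e x ≠ hA.affinePerm e (A i) := fun h => hx (Equiv.injective _ h)
  have h2 := hA.affinePerm_lt_iff e i x
  rw [← not_iff_not, not_lt, le_iff_lt_or_eq, or_iff_left h1, h2, not_and_or, not_not]

theorem IsResidueSystem.ncard_inversions_affinePerm {m n : ℕ} [NeZero n] {A : Fin n → ℤ}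
    (hA : IsResidueSystem A) (e : Equiv.Perm (Fin n)) :
    {p : ℤ × ℤ | 1 ≤ p.1 ∧ p.1 ≤ n ∧ p.1 < p.2 ∧ p.2 < p.1 + m ∧
      hA.affinePerm e p.2 < hA.affinePerm e p.1}.ncard =
        generatorGaps m A + generatorInversions m A e := by
  rw [ncard_inversions, (hA.isAffine_affinePerm e).sum_inversions_above hA, generatorGaps,
    generatorInversions, ← Finset.sum_add_distrib]
  refine Finset.sum_congr rfl fun i _ => ?_
  rw [← Finset.sum_add_distrib]
  refine Finset.sum_congr rfl fun d _ => ?_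
  have h := hA.affinePerm_lt_iff e i (A i + d)
  have h1 : A i + d ∉ generatedSet A → ¬ ∃ j, A j = A i + d ∧ e j < e i := by
    rintro h1 ⟨j, hj, -⟩
    exact h1 (hj ▸ mem_generatedSet A j)
  split_ifs <;> first | rfl | (exfalso; grind)

theorem generatorInversions_sort {m n : ℕ} (A : Fin n → ℤ) :
    generatorInversions m A (Tuple.sort A).symm = 0 := by
  refine Finset.sum_eq_zero fun i _ => Finset.sum_eq_zero fun d hd => if_neg ?_
  rintro ⟨j, hj, h⟩
  have h2 := Tuple.monotone_sort A h.le
  rw [Finset.mem_Ioo] at hd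
  simp at h2
  omega

/-! ### Moving the generators one after the other -/

/-- The set obtained from `generatedSet A` by moving each generator `A i` with `e i < k` to
`A i - m`. -/
def movedSet (m : ℕ) {n : ℕ} (A : Fin n → ℤ) (e : Equiv.Perm (Fin n)) (k : ℕ) : Set ℤ :=
  {x | (x ∈ generatedSet A ∧ ¬ ∃ j, A j = x ∧ (e j : ℕ) < k) ∨ ∃ j, A j - m = x ∧ (e j : ℕ) < k}

theorem movedSet_zero (m : ℕ) {n : ℕ} (A : Fin n → ℤ) (e : Equiv.Perm (Fin n)) :
    movedSet m A e 0 = generatedSet A := by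
  simp [movedSet]

theorem IsResidueSystem.movedSet_self {n : ℕ} [NeZero n] {A : Fin n → ℤ}
    (hA : IsResidueSystem A) (m : ℕ) (e : Equiv.Perm (Fin n)) :
    movedSet m A e n = jumpSet m n (generatedSet A) := by
  -- Shifting the set by `n` removes exactly its generators.
  have h1 : ∀ x, x ∈ (fun a => a + (n : ℤ)) '' generatedSet A ↔
      x ∈ generatedSet A ∧ ¬ ∃ j, A j = x := by
    intro x
    obtain ⟨i, q, rfl⟩ := hA.exists_eq_add x
    have h2 : A i + n * q ∈ (fun a => a + (n : ℤ)) '' generatedSet A ↔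
        A i + n * (q - 1) ∈ generatedSet A := by
      simp only [Set.mem_image]
      constructor
      · rintro ⟨y, hy, h⟩
        rwa [show A i + n * (q - 1) = y by linarith]
      · intro h
        exact ⟨_, h, by ring⟩
    rw [h2, hA.add_mul_mem_iff, hA.add_mul_mem_iff]
    constructor
    · intro h
      refine ⟨by omega, ?_⟩
      rintro ⟨j, hj⟩
      have := (hA.eq_of_add_eq (q := 0) (r := q) (by rw [← hj]; ring)).2
      omega
    · rintro ⟨h, h3⟩
      rcases h.eq_or_lt with rfl | h
      · exact absurd ⟨i, by simp⟩ h3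
      · omega
  ext x
  simp only [movedSet, jumpSet, Set.mem_ofPred_eq, Set.mem_union, h1, (e _).isLt, and_true]
  rw [or_comm]
  refine or_congr_left ?_
  simp only [Set.mem_image, Set.mem_sdiff]
  constructor
  · rintro ⟨j, rfl⟩
    refine ⟨A j, ⟨mem_generatedSet A j, ?_⟩, rfl⟩
    have := h1 (A j)
    simp only [Set.mem_image] at this
    rw [this]
    exact fun h => h.2 ⟨j, rfl⟩
  · rintro ⟨y, ⟨hy, hy'⟩, rfl⟩
    have := h1 y
    simp only [Set.mem_image] at this
    rw [this] at hy'
    push Not at hy'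
    obtain ⟨j, rfl⟩ := hy' hy
    exact ⟨j, rfl⟩

-- When `A i` moves, the occupied places strictly between `A i - m` and `A i` are of two kinds. An
-- unmoved element of the original set has a larger ω-value than `A i`, so it is an inversion with
-- right end `A i`; these total gaps plus generator inversions. A place `A j - m` taken earlier
-- corresponds to the generator inversion between `A i` and `A j`.
open Classical in
theorem IsResidueSystem.sum_card_movedSet {m n : ℕ} [NeZero n] {A : Fin n → ℤ}
    (hA : IsResidueSystem A) (hm : ∀ x ∈ generatedSet A, x + m ∈ generatedSet A)
    {e : Equiv.Perm (Fin n)} (he : IsAdmissible m A e) :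
    (∑ k : Fin n, ((Finset.Ioo (A (e.symm k) - m) (A (e.symm k))).filter
      (· ∈ movedSet m A e k)).card) =
        generatorGaps m A + 2 * generatorInversions m A e := by
  have h1 : (∑ i, ∑ d ∈ Finset.Ioo (0 : ℤ) m,
      if hA.affinePerm e (A i) < hA.affinePerm e (A i - d) then 1 else 0) =
        generatorGaps m A + generatorInversions m A e := by
    rw [← (hA.isAffine_affinePerm e).sum_inversions_below hA, ← ncard_inversions,
      hA.ncard_inversions_affinePerm]
  have h2 : generatorInversions m A e = ∑ i, ∑ d ∈ Finset.Ioo (0 : ℤ) m,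
      if ∃ j, A j - m = A i - d ∧ e j < e i then 1 else 0 := by
    refine Finset.sum_congr rfl fun i _ => ?_
    -- `A j - m = A i - d` says that `A j` lies `m - d` above `A i`.
    refine Finset.sum_nbij' (fun d => m - d) (fun d => m - d) ?_ ?_ ?_ ?_ ?_
    · intro d hd
      rw [Finset.mem_Ioo] at hd ⊢
      omega
    · intro d hd
      rw [Finset.mem_Ioo] at hd ⊢
      omega
    · intro d _
      simp
    · intro d _
      simp
    · intro d _
      refine if_congr (exists_congr fun j => and_congr_left' ?_) rfl rfl
      constructor <;> intro _ <;> omega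
  rw [two_mul, ← add_assoc, ← h1]
  rw [h2]
  rw [← Finset.sum_add_distrib, ← Equiv.sum_comp e]
  refine Finset.sum_congr rfl fun i _ => ?_
  rw [← Finset.sum_add_distrib, Equiv.symm_apply_apply, Finset.card_filter]
  refine Finset.sum_nbij' (fun x => A i - x) (fun d => A i - d) ?_ ?_ ?_ ?_ ?_
  · intro x hx
    rw [Finset.mem_Ioo] at hx ⊢
    omega
  · intro d hd
    rw [Finset.mem_Ioo] at hd ⊢
    omega
  · intro d _
    simp
  · intro d _
    simp
  · intro x hx
    rw [Finset.mem_Ioo] at hx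
    rw [sub_sub_cancel]
    have h3 := hA.lt_affinePerm_iff e i (x := x) (by omega)
    have h4 : x ∈ movedSet m A e (e i) ↔ (x ∈ generatedSet A ∧ ¬ ∃ j, A j = x ∧ e j < e i) ∨
      ∃ j, A j - m = x ∧ e j < e i := Iff.rfl
    -- The two kinds are disjoint: if `A j - m` was in the original set, it was a generator, which
    -- admissibility has moved before `A j`.
    have h5 : (∃ j, A j - m = x ∧ e j < e i) →
        ¬ (x ∈ generatedSet A ∧ ¬ ∃ j, A j = x ∧ e j < e i) := by
      rintro ⟨j, rfl, hj⟩ ⟨hx', h6⟩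
      obtain ⟨l, hl⟩ := hA.eq_of_add_eq_mem hm hx'
      exact h6 ⟨l, by omega, (he l j hl).trans hj⟩
    rw [← h3] at h4 h5
    split_ifs <;> first | rfl | (exfalso; grind)

theorem IsResidueSystem.dinvPerm_affinePerm {m n : ℕ} [NeZero n] {A : Fin n → ℤ}
    (hA : IsResidueSystem A) (e : Equiv.Perm (Fin n)) :
    dinvPerm m n (hA.affinePerm e) =
      delta m n - (generatorGaps m A + generatorInversions m A e : ℕ) := by
  rw [dinvPerm, hA.ncard_inversions_affinePerm]

/-! ### The generators attached to a sequence of row lengths -/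

/-- The weights of the rightmost boxes of rows with the lengths `L i`. -/
def rowWeights (m : ℕ) {n : ℕ} (M : ℤ) (L : Fin n → ℕ) (i : Fin n) : ℤ :=
  boxWeight m n M i ((L i : ℤ) - 1)

/-- Modulo `n` the weight in row `i` is `M - m (i + 1)`, and `m` is invertible. -/
theorem isResidueSystem_rowWeights {m n : ℕ} (hmn : Nat.Coprime m n) (M : ℤ) (L : Fin n → ℕ) :
    IsResidueSystem (rowWeights m M L) := by
  intro i j h
  have h1 : (n : ℤ) ∣ m * ((j : ℤ) - i) := by
    have h2 : (m : ℤ) * ((j : ℤ) - i) =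
        (rowWeights m M L i - rowWeights m M L j) + n * ((L i : ℤ) - L j) := by
      simp only [rowWeights, boxWeight]
      ring
    rw [h2]
    exact dvd_add h (dvd_mul_right _ _)
  have h2 : IsCoprime (n : ℤ) m := Nat.isCoprime_iff_coprime.2 hmn.symm
  have h3 := Int.eq_zero_of_abs_lt_dvd (h2.dvd_of_dvd_mul_left h1) (by rw [abs_lt]; omega)
  apply Fin.ext
  omega

theorem two_dvd_of_coprime {m n : ℕ} (hmn : Nat.Coprime m n) :
    (2 : ℤ) ∣ ((m : ℤ) - 1) * ((n : ℤ) - 1) := by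
  rcases Nat.even_or_odd m with h | h
  · have h1 : Odd n := by
      rw [← Nat.not_even_iff_odd]
      intro h1
      have := Nat.dvd_gcd h.two_dvd h1.two_dvd
      rw [hmn.gcd_eq_one] at this
      omega
    obtain ⟨k, rfl⟩ := h1
    exact ⟨((m : ℤ) - 1) * k, by push_cast; ring⟩
  · obtain ⟨k, rfl⟩ := h
    exact ⟨k * ((n : ℤ) - 1), by push_cast; ring⟩

/-- Every weight contains `M` once, so the normalisation of ω determines the minimum of Δ_ω from the
row lengths. -/
theorem sum_rowWeights_iff {m n : ℕ} (hn : 0 < n) (hmn : Nat.Coprime m n) (M : ℤ)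
    (L : Fin n → ℕ) :
    ∑ i, rowWeights m M L i = (n : ℤ) * (n + 1) / 2 ↔
      M = 1 - (((m : ℤ) - 1) * ((n : ℤ) - 1) / 2 - ∑ i, (L i : ℤ)) := by
  obtain ⟨c, hc⟩ := two_dvd_of_coprime hmn
  rw [hc, Int.mul_ediv_cancel_left _ two_ne_zero]
  have h2 : (n : ℤ) * (n + 1) / 2 * 2 = n * (n + 1) :=
    Int.ediv_mul_cancel (Int.even_mul_succ_self n).two_dvd
  have h1 : ∑ i : Fin n, ((i : ℤ) + 1) = (n : ℤ) * (n + 1) / 2 := sum_fin_add_one n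
  have h3 : ∑ i, rowWeights m M L i =
      n * (m * n + M) - m * ((n : ℤ) * (n + 1) / 2) - n * ∑ i, (L i : ℤ) := by
    rw [← h1, Finset.mul_sum, Finset.mul_sum, ← nsmul_eq_mul, ← Fin.sum_const,
      ← Finset.sum_sub_distrib, ← Finset.sum_sub_distrib]
    refine Finset.sum_congr rfl fun i _ => ?_
    simp only [rowWeights, boxWeight]
    ring
  rw [h3]
  have h4 : (n : ℤ) ≠ 0 := by exact_mod_cast hn.ne'
  constructor
  · intro h
    have h5 : (n : ℤ) * (2 * (M - (1 - (c - ∑ i, (L i : ℤ))))) = 0 := by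
      linear_combination 2 * h + (m + 1) * h2 - n * hc
    have := (mul_eq_zero.1 h5).resolve_left h4
    omega
  · rintro rfl
    apply mul_right_cancel₀ (two_ne_zero (α := ℤ))
    linear_combination (- (m : ℤ) - 1) * h2 + n * hc

/-! ### Dyck paths -/

theorem rowLen_eq_zero_of_fits {m n : ℕ} {D : YoungDiagram}
    (hD : FitsUnderDiagonal m n D) (hn : 0 < n) {i : ℕ} (hi : n ≤ i + 1) : D.rowLen i = 0 := by
  by_contra h
  have h1 := hD (i, 0) (YoungDiagram.mem_iff_lt_rowLen.2 (Nat.pos_of_ne_zero h))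
  have h2 : m * n ≤ m * (i + 1) := Nat.mul_le_mul_left m hi
  simp only at h1
  omega

theorem rowLen_le_of_fits {m n : ℕ} {D : YoungDiagram}
    (hD : FitsUnderDiagonal m n D) {i : ℕ} (hi : i < n) :
    m * (i + 1) + n * D.rowLen i ≤ m * n := by
  rcases Nat.eq_zero_or_pos (D.rowLen i) with h | h
  · rw [h, mul_zero, add_zero]
    exact Nat.mul_le_mul_left m hi
  · have h1 := hD (i, D.rowLen i - 1) (YoungDiagram.mem_iff_lt_rowLen.2 (by omega))
    simpa [Nat.sub_add_cancel h] using h1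

/-- The minimal element of `Δ_D`. -/
def dyckMin (m n : ℕ) (D : YoungDiagram) : ℤ :=
  1 - (((m : ℤ) - 1) * ((n : ℤ) - 1) / 2 - ∑ i : Fin n, (D.rowLen i : ℤ))

/-- The `n`-generators of `Δ_D`, indexed by the rows. -/
def dyckGen (m n : ℕ) (D : YoungDiagram) : Fin n → ℤ :=
  rowWeights m (dyckMin m n D) fun i => D.rowLen i

section Dyck

variable {m n : ℕ} {D : YoungDiagram}

theorem dyckGen_apply (i : Fin n) : dyckGen m n D i =
    m * n - m - n + dyckMin m n D - m * i - n * (D.rowLen i - 1) := rfl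

theorem isResidueSystem_dyckGen (hmn : Nat.Coprime m n) : IsResidueSystem (dyckGen m n D) :=
  isResidueSystem_rowWeights hmn _ _

theorem sum_dyckGen (hn : 0 < n) (hmn : Nat.Coprime m n) :
    ∑ i, dyckGen m n D i = (n : ℤ) * (n + 1) / 2 :=
  (sum_rowWeights_iff hn hmn _ _).2 rfl

/-- Modulo `n`, adding `m` goes down one row; from the bottom row it wraps around to the top one
(`dyckGen_add_of_zero`). -/
theorem dyckGen_add_of_pos {i j : Fin n} (h : (j : ℕ) = i + 1) :
    dyckGen m n D j + m = dyckGen m n D i + n * ((D.rowLen i : ℤ) - D.rowLen j) := by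
  rw [dyckGen_apply, dyckGen_apply, h]
  push_cast
  ring

theorem dyckGen_add_of_zero (hD : FitsUnderDiagonal m n D) {i j : Fin n} (hi : (i : ℕ) = 0)
    (hj : (j : ℕ) + 1 = n) :
    dyckGen m n D i + m = dyckGen m n D j + n * ((m : ℤ) - D.rowLen i) := by
  rw [dyckGen_apply, dyckGen_apply, hi, rowLen_eq_zero_of_fits hD (by omega) hj.ge]
  have : (n : ℤ) = j + 1 := by exact_mod_cast hj.symm
  rw [this]
  push_cast
  ring

theorem rowLen_zero_lt (hD : FitsUnderDiagonal m n D) (hm : 0 < m) (hn : 0 < n) :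
    D.rowLen 0 < m := by
  have h := rowLen_le_of_fits hD hn
  by_contra! h1
  have := Nat.mul_le_mul_left n h1
  rw [mul_comm m n] at h
  omega

/-- The multiples of `n` that appear when passing from row to row are nonnegative: row lengths
decrease upwards, and the bottom row is shorter than `m`. -/
theorem generatedSet_dyckGen_add (hD : FitsUnderDiagonal m n D) (hm : 0 < m) :
    ∀ x ∈ generatedSet (dyckGen m n D), x + m ∈ generatedSet (dyckGen m n D) := by
  rintro _ ⟨j, k, rfl⟩
  have hj := j.isLt
  rcases Nat.eq_zero_or_pos (j : ℕ) with h | h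
  · have h1 := dyckGen_add_of_zero hD h (j := ⟨n - 1, by omega⟩) (by simp; omega)
    refine ⟨⟨n - 1, by omega⟩, m - D.rowLen j + k, ?_⟩
    have := rowLen_zero_lt hD hm (by omega)
    rw [h] at *
    push_cast [this.le]
    linarith
  · have h1 := dyckGen_add_of_pos (m := m) (D := D) (i := ⟨j - 1, by omega⟩) (j := j)
      (by simp; omega)
    have := D.rowLen_anti (j - 1) j (Nat.sub_le _ _)
    refine ⟨⟨j - 1, by omega⟩, D.rowLen (j - 1) - D.rowLen j + k, ?_⟩
    push_cast [this]
    simp only at h1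
    linarith

/-- The multiple of `n` must vanish, which excludes the wrap-around since `rowLen 0 < m`.
Admissibility thus compares exactly the labels of vertically adjacent boxes. -/
theorem dyckGen_eq_add_iff (hmn : Nat.Coprime m n) (hD : FitsUnderDiagonal m n D) (hm : 0 < m)
    {i j : Fin n} (h : dyckGen m n D i = dyckGen m n D j + m) :
    (j : ℕ) = i + 1 ∧ D.rowLen i = D.rowLen j := by
  have hj := j.isLt
  have : NeZero n := ⟨by omega⟩
  rcases Nat.eq_zero_or_pos (j : ℕ) with h0 | h0
  · have h1 := dyckGen_add_of_zero hD h0 (j := ⟨n - 1, by omega⟩) (by simp; omega)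
    have h2 := ((isResidueSystem_dyckGen hmn).eq_of_add_eq (q := 0)
      (by rw [← h1, h, mul_zero, add_zero])).2
    have := rowLen_zero_lt hD hm (by omega)
    rw [h0] at h2
    omega
  · have h1 := dyckGen_add_of_pos (m := m) (D := D) (i := ⟨j - 1, by omega⟩) (j := j)
      (by simp; omega)
    obtain ⟨h2, h3⟩ := (isResidueSystem_dyckGen hmn).eq_of_add_eq (q := 0)
      (by rw [← h1, h, mul_zero, add_zero])
    have h4 := congrArg Fin.val h2
    simp only at h3 h4
    rw [h4]
    omega

theorem dyckGen_eq_add_mul {i j : Fin n} (hij : i ≤ j) (h : D.rowLen i = D.rowLen j) :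
    dyckGen m n D i = dyckGen m n D j + m * ((j - i : ℕ) : ℤ) := by
  rw [dyckGen_apply, dyckGen_apply, h, Nat.cast_sub hij]
  ring

/-- The minimum is attained in the top row, which is empty; for the other rows, `A i ≥ dyckMin` is
precisely the diagonal condition at the end of the row. -/
theorem sInf_generatedSet_dyckGen (hD : FitsUnderDiagonal m n D) (hn : 0 < n) :
    sInf (generatedSet (dyckGen m n D)) = dyckMin m n D := by
  refine IsLeast.csInf_eq ⟨?_, ?_⟩
  · refine ⟨⟨n - 1, by omega⟩, 0, ?_⟩
    rw [dyckGen_apply, rowLen_eq_zero_of_fits hD hn (by simp; omega)]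
    push_cast [hn]
    ring
  · rintro _ ⟨i, k, rfl⟩
    have h := rowLen_le_of_fits hD i.isLt
    have h1 : (m : ℤ) * (i + 1) + n * D.rowLen i ≤ m * n := by exact_mod_cast h
    have h2 : 0 ≤ (n : ℤ) * k := by positivity
    rw [dyckGen_apply]
    linarith

/-! ### Parking functions and admissible permutations -/

/-- `rowLabel f` is the permutation that sorts by decreasing value, then by decreasing label. -/
theorem rowLabel_eq_iff {f : Fin n → ℕ} {e : Equiv.Perm (Fin n)} :
    e = rowLabel f ↔ ∀ i j, i < j → f (e j) < f (e i) ∨ (f (e j) = f (e i) ∧ e j < e i) := by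
  rw [rowLabel, Tuple.eq_sort_iff]
  constructor
  · rintro ⟨h, -⟩ i j hij
    have h1 := h hij.le
    simp only [Function.comp_apply, Prod.Lex.toLex_le_toLex, OrderDual.toDual_lt_toDual,
      OrderDual.toDual_le_toDual, OrderDual.toDual_inj] at h1
    rcases h1 with h1 | ⟨h1, h2⟩
    · exact Or.inl h1
    · exact Or.inr ⟨h1.symm, lt_of_le_of_ne h2 fun h3 => hij.ne (e.injective h3.symm)⟩
  · intro h
    have h1 : ∀ i j, i < j →
        toLex (OrderDual.toDual (f (e i)), OrderDual.toDual (e i)) <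
          toLex (OrderDual.toDual (f (e j)), OrderDual.toDual (e j)) := by
      intro i j hij
      rw [Prod.Lex.toLex_lt_toLex]
      rcases h i j hij with h2 | ⟨h2, h3⟩
      · exact Or.inl h2
      · exact Or.inr ⟨by rw [h2], h3⟩
    exact ⟨fun i j hij => hij.eq_or_lt.elim (fun h2 => by rw [h2]) fun h2 => (h1 i j h2).le,
      fun i j hij h2 => absurd h2 (h1 i j hij).ne⟩

theorem diagram_eq_iff [NeZero n] (hD : FitsUnderDiagonal m n D) {f : Fin n → ℕ} :
    diagram f = D ↔ ∀ i : Fin n, f (rowLabel f i) = D.rowLen i := by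
  have hmem : ∀ i j, (i, j) ∈ diagram f ↔ ∃ h : i < n, j < f (rowLabel f ⟨i, h⟩) := by
    intro i j
    rw [diagram, YoungDiagram.mem_ofRowLens]
    simp
  constructor
  · intro h i
    apply eq_of_forall_lt_iff
    intro j
    rw [← YoungDiagram.mem_iff_lt_rowLen, ← h, hmem]
    simp
  · intro h
    ext ⟨i, j⟩
    rw [YoungDiagram.mem_cells, YoungDiagram.mem_cells, hmem, YoungDiagram.mem_iff_lt_rowLen]
    constructor
    · rintro ⟨hi, hj⟩
      rwa [h] at hj
    · intro hj
      have hi : i < n := by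
        by_contra! hi
        have h1 := hD (i, j) (YoungDiagram.mem_iff_lt_rowLen.2 hj)
        have h2 : m * n ≤ m * i := Nat.mul_le_mul_left m hi
        simp only [mul_add, mul_one] at h1
        have := NeZero.pos n
        omega
      exact ⟨hi, by rwa [h]⟩

theorem mem_parkingFunctions_iff [NeZero n] (hD : FitsUnderDiagonal m n D) {f : Fin n → ℕ} :
    f ∈ parkingFunctions m n D ↔ ∀ i : Fin n, f (rowLabel f i) = D.rowLen i := by
  rw [← diagram_eq_iff hD]
  exact ⟨fun h => h.2, fun h => ⟨h ▸ hD, h⟩⟩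

theorem isAdmissible_rowLabel [NeZero n] (hmn : Nat.Coprime m n) (hD : FitsUnderDiagonal m n D) (hm : 0 < m)
    {f : Fin n → ℕ} (hf : f ∈ parkingFunctions m n D) :
    IsAdmissible m (dyckGen m n D) (rowLabel f) := by
  intro i j h
  obtain ⟨h1, h2⟩ := dyckGen_eq_add_iff hmn hD hm h
  have h3 := rowLabel_eq_iff.1 (rfl : rowLabel f = rowLabel f) j i (by rw [Fin.lt_def]; omega)
  rw [mem_parkingFunctions_iff hD] at hf
  rw [hf, hf, h2] at h3
  rcases h3 with h3 | h3
  · exact absurd h3 (lt_irrefl _)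
  · exact h3.2

theorem IsStable.lt_add_mul {ω : Equiv.Perm ℤ} (hω : IsStable m n ω) (x : ℤ) {c : ℕ}
    (hc : 0 < c) : ω x < ω (x + m * c) := by
  induction c, hc using Nat.le_induction with
  | base => simpa using hω.2.2 x
  | succ c _ ih =>
    refine ih.trans ?_
    have := hω.2.2 (x + m * c)
    rw [show x + m * ((c + 1 : ℕ) : ℤ) = x + m * c + m by push_cast; ring]
    exact this

/-- Admissibility only relates adjacent rows; iterating the stability of the affine permutation
compares any two rows of equal length. -/
theorem rowLabel_comp_symm [NeZero n] (hmn : Nat.Coprime m n) (hD : FitsUnderDiagonal m n D)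
    (hm : 0 < m) {e : Equiv.Perm (Fin n)} (he : IsAdmissible m (dyckGen m n D) e) :
    rowLabel (fun k => D.rowLen (e.symm k)) = e := by
  symm
  rw [rowLabel_eq_iff]
  intro i j hij
  simp only [Equiv.symm_apply_apply]
  rcases (D.rowLen_anti i j hij.le).lt_or_eq with h | h
  · exact Or.inl h
  · refine Or.inr ⟨h, ?_⟩
    have hA := isResidueSystem_dyckGen (D := D) hmn
    have hω := hA.isStable_affinePerm (sum_dyckGen (NeZero.pos n) hmn)
      (generatedSet_dyckGen_add hD hm) he
    have h1 := hω.lt_add_mul (dyckGen m n D j) (c := j - i) (by omega)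
    rw [← dyckGen_eq_add_mul hij.le h.symm, hA.affinePerm_apply, hA.affinePerm_apply] at h1
    rw [Fin.lt_def]
    omega

theorem comp_symm_mem_parkingFunctions [NeZero n] (hmn : Nat.Coprime m n)
    (hD : FitsUnderDiagonal m n D) (hm : 0 < m) {e : Equiv.Perm (Fin n)}
    (he : IsAdmissible m (dyckGen m n D) e) :
    (fun k => D.rowLen (e.symm k)) ∈ parkingFunctions m n D := by
  rw [mem_parkingFunctions_iff hD, rowLabel_comp_symm hmn hD hm he]
  simp

theorem eq_comp_symm_rowLabel [NeZero n] (hD : FitsUnderDiagonal m n D) {f : Fin n → ℕ}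
    (hf : f ∈ parkingFunctions m n D) : f = fun k => D.rowLen ((rowLabel f).symm k) := by
  funext k
  rw [mem_parkingFunctions_iff hD] at hf
  rw [← hf, Equiv.apply_symm_apply]

theorem bijOn_rowLabel [NeZero n] (hmn : Nat.Coprime m n) (hD : FitsUnderDiagonal m n D)
    (hm : 0 < m) :
    Set.BijOn rowLabel (parkingFunctions m n D) {e | IsAdmissible m (dyckGen m n D) e} := by
  refine ⟨fun f hf => isAdmissible_rowLabel hmn hD hm hf, fun f hf g hg h => ?_, fun e he => ?_⟩
  · rw [eq_comp_symm_rowLabel hD hf, eq_comp_symm_rowLabel hD hg, h]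
  · exact ⟨_, comp_symm_mem_parkingFunctions hmn hD hm he, rowLabel_comp_symm hmn hD hm he⟩

theorem area_eq [NeZero n] (hD : FitsUnderDiagonal m n D) {f : Fin n → ℕ}
    (hf : f ∈ parkingFunctions m n D) : 1 - area m f = dyckMin m n D := by
  rw [mem_parkingFunctions_iff hD] at hf
  rw [area, dyckMin, ← Equiv.sum_comp (rowLabel f)]
  simp only [hf]

/-- The labelled box is one column to the right of the last box of its row, hence the shift by `n`.
-/
theorem labelWeight_eq [NeZero n] (hD : FitsUnderDiagonal m n D) {f : Fin n → ℕ}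
    (hf : f ∈ parkingFunctions m n D) (k : Fin n) :
    labelWeight m f k = dyckGen m n D ((rowLabel f).symm k) - n := by
  rw [labelWeight, area_eq hD hf, dyckGen_apply, boxWeight]
  rw [mem_parkingFunctions_iff hD] at hf
  rw [← hf, Equiv.apply_symm_apply]
  ring

theorem sort_symm_lt_iff {α : Type*} [LinearOrder α] {g : Fin n → α}
    (hg : Function.Injective g) (a b : Fin n) :
    (Tuple.sort g).symm a < (Tuple.sort g).symm b ↔ g a < g b := by
  have h : StrictMono (g ∘ Tuple.sort g) :=
    (Tuple.monotone_sort g).strictMono_of_injective (hg.comp (Tuple.sort g).injective)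
  rw [← h.lt_iff_lt]
  simp

/-- The inverse of the diagonal word sends a label to the rank of its weight, so its descents are
those of the generators listed by label. -/
theorem ides_eq [NeZero n] (hmn : Nat.Coprime m n) (hD : FitsUnderDiagonal m n D) {f : Fin n → ℕ}
    (hf : f ∈ parkingFunctions m n D) :
    ides m f = descents fun k => dyckGen m n D ((rowLabel f).symm k) := by
  have hinj : Function.Injective (labelWeight m f) := by
    intro a b h
    rw [labelWeight_eq hD hf, labelWeight_eq hD hf] at h
    exact (rowLabel f).symm.injective ((isResidueSystem_dyckGen hmn).injective (by linarith))
  ext k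
  simp only [ides, diagonalWord, descents, sort_symm_lt_iff hinj, labelWeight_eq hD hf,
    sub_lt_sub_iff_right]

end Dyck

/-! ### The parking function of a stable affine permutation -/

section Anderson

variable {m n : ℕ} {ω : Equiv.Perm ℤ}

theorem IsStable.add_mem (hω : IsStable m n ω) {x : ℤ} (hx : x ∈ positiveSet ω) (a b : ℕ) :
    x + m * a + n * b ∈ positiveSet ω := by
  rw [positiveSet, Set.mem_ofPred_eq] at hx ⊢
  rw [IsAffine.apply_add_mul hω.1]
  have h1 : ω x ≤ ω (x + m * a) := by
    rcases Nat.eq_zero_or_pos a with rfl | h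
    · simp
    · exact (hω.lt_add_mul x h).le
  have h2 : 0 ≤ (n : ℤ) * b := by positivity
  linarith

theorem mem_iff_lt_ncard {S : Set ℕ} (hS : ∀ a ∈ S, ∀ b ≤ a, b ∈ S) {B : ℕ} (hB : B ∉ S) (j : ℕ) :
    j ∈ S ↔ j < S.ncard := by
  classical
  have hex : ∃ b, b ∉ S := ⟨B, hB⟩
  have h : S = (Finset.range (Nat.find hex) : Set ℕ) := by
    ext a
    rw [Finset.mem_coe, Finset.mem_range]
    constructor
    · intro ha
      by_contra! h
      exact Nat.find_spec hex (hS a ha _ h)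
    · intro ha
      by_contra h
      exact Nat.find_min hex ha h
  have h1 : S.ncard = Nat.find hex := by
    conv_lhs => rw [h]
    rw [Set.ncard_coe_finset, Finset.card_range]
  rw [h1]
  conv_lhs => rw [h]
  simp

theorem IsStable.mem_stableDiagram_iff (hω : IsStable m n ω) {i j : ℕ} :
    (i, j) ∈ stableDiagram m n ω ↔ j < stableRowLen m n ω i := by
  refine mem_iff_lt_ncard (S := {j | (i, j) ∈ stableDiagram m n ω}) ?_ (B := m) ?_ j
  · rintro a ⟨h1, h2, h3⟩ b hb
    refine ⟨h1, hb.trans_lt h2, ?_⟩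
    have h4 := hω.add_mem h3 0 (a - b)
    convert h4 using 1
    simp only [boxWeight]
    push_cast [hb]
    ring
  · rintro ⟨-, h2, -⟩
    exact lt_irrefl _ h2

theorem IsStable.stableRowLen_anti (hω : IsStable m n ω) {i j : ℕ} (hij : i ≤ j) :
    stableRowLen m n ω j ≤ stableRowLen m n ω i := by
  by_contra! h
  have h1 : ¬ (stableRowLen m n ω i) < stableRowLen m n ω i := lt_irrefl _
  rw [← hω.mem_stableDiagram_iff] at h h1
  obtain ⟨h2, h3, h4⟩ := h
  refine h1 ⟨by exact hij.trans_lt h2, h3, ?_⟩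
  have h5 := hω.add_mem h4 (j - i) 0
  convert h5 using 1
  simp only [boxWeight]
  push_cast [hij]
  ring

theorem IsStable.stableRowWeight_eq (i : Fin n) : stableRowWeight m n ω i =
    rowWeights m (sInf (positiveSet ω)) (fun i : Fin n => stableRowLen m n ω i) i := rfl

/-- An `m`-stable affine permutation is determined by its parking function. -/
theorem IsStable.eq_affinePerm_of_isAnderson [NeZero n] {D : YoungDiagram}
    (hω : IsStable m n ω) (hmn : Nat.Coprime m n)
    (hD : FitsUnderDiagonal m n D) {f : Fin n → ℕ} (hf : f ∈ parkingFunctions m n D)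
    (h : IsAnderson m n ω f) :
    ω = (isResidueSystem_dyckGen (D := D) hmn).affinePerm (rowLabel f) := by
  choose k hk hL using h
  simp only [IsStable.stableRowWeight_eq] at hk
  have hres := isResidueSystem_rowWeights hmn (sInf (positiveSet ω))
    (fun i : Fin n => stableRowLen m n ω i)
  have hinj : Function.Injective k := by
    intro i j hij
    apply hres.injective
    apply ω.injective
    rw [hk, hk, hij]
  let e : Equiv.Perm (Fin n) := Equiv.ofBijective k (Finite.injective_iff_bijective.1 hinj)
  -- Row lengths of D_ω decrease weakly, and within equal lengths stability makes the labels
  -- decrease upwards; this characterises `rowLabel f`.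
  have he : e = rowLabel f := by
    rw [rowLabel_eq_iff]
    intro i j hij
    simp only [e, Equiv.ofBijective_apply, hL]
    rcases (hω.stableRowLen_anti hij.le).lt_or_eq with h1 | h1
    · exact Or.inl h1
    · refine Or.inr ⟨h1, ?_⟩
      have h2 := hω.lt_add_mul (rowWeights m (sInf (positiveSet ω))
        (fun i : Fin n => stableRowLen m n ω i) j) (c := j - i) (by omega)
      have h3 : rowWeights m (sInf (positiveSet ω)) (fun i : Fin n => stableRowLen m n ω i) j +
          m * ((j - i : ℕ) : ℤ) =
          rowWeights m (sInf (positiveSet ω)) (fun i : Fin n => stableRowLen m n ω i) i := by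
        simp only [rowWeights, boxWeight, h1]
        rw [Nat.cast_sub hij.le]
        ring
      rw [h3, hk, hk] at h2
      rw [Fin.lt_def]
      omega
  have hf' := (mem_parkingFunctions_iff hD).1 hf
  have hlen : (fun i : Fin n => stableRowLen m n ω i) = fun i : Fin n => D.rowLen i := by
    funext i
    rw [← hf', ← he]
    exact (hL i).symm
  -- The row lengths give the generators up to the additive constant, which the normalisation now
  -- fixes.
  have hsum := IsAffine.sum_residueSystem hω.1 hres
  rw [hω.2.1, sub_self] at hsum
  have hsum2 : ∑ i, ω (rowWeights m (sInf (positiveSet ω))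
      (fun i : Fin n => stableRowLen m n ω i) i) = (n : ℤ) * (n + 1) / 2 := by
    rw [← sum_fin_add_one, ← Equiv.sum_comp e fun i : Fin n => (i : ℤ) + 1]
    exact Finset.sum_congr rfl fun i _ => hk i
  have hM := (sum_rowWeights_iff (NeZero.pos n) hmn (sInf (positiveSet ω))
    (fun i : Fin n => stableRowLen m n ω i)).1 (by linarith)
  simp only [congrFun hlen] at hM
  have hA : rowWeights m (sInf (positiveSet ω)) (fun i : Fin n => stableRowLen m n ω i) =
      dyckGen m n D := by
    rw [hM, hlen]
    rfl
  rw [← he]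
  refine IsResidueSystem.eq_affinePerm _ hω.1 fun i => ?_
  rw [← hA]
  exact hk i

theorem isAnderson_affinePerm [NeZero n] {D : YoungDiagram} (hmn : Nat.Coprime m n)
    (hD : FitsUnderDiagonal m n D) (hm : 0 < m) (e : Equiv.Perm (Fin n)) :
    IsAnderson m n ((isResidueSystem_dyckGen (D := D) hmn).affinePerm e)
      (fun k => D.rowLen (e.symm k)) := by
  have hA := isResidueSystem_dyckGen (D := D) hmn
  have hn := NeZero.pos n
  intro i
  have hlen : stableRowLen m n (hA.affinePerm e) i = D.rowLen i := by
    have h1 : {j : ℕ | ((i : ℕ), j) ∈ stableDiagram m n (hA.affinePerm e)} =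
        (Finset.range (D.rowLen i) : Set ℕ) := by
      ext j
      rw [Finset.mem_coe, Finset.mem_range, Set.mem_ofPred_eq, stableDiagram, Set.mem_ofPred_eq,
        hA.positiveSet_affinePerm, sInf_generatedSet_dyckGen hD hn]
      -- Going left along a row adds `n` per column, so exactly the columns before `rowLen i` have
      -- weights in the set.
      have h2 : boxWeight m n (dyckMin m n D) i j =
          dyckGen m n D i + n * ((D.rowLen i : ℤ) - 1 - j) := by
        rw [dyckGen_apply, boxWeight]
        ring
      simp only
      rw [h2, hA.add_mul_mem_iff]
      constructor
      · rintro ⟨-, -, h⟩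
        omega
      · intro h
        have h3 := D.rowLen_anti 0 i (Nat.zero_le _)
        have h4 := rowLen_zero_lt hD hm hn
        exact ⟨i.isLt, by omega, by omega⟩
    rw [stableRowLen, h1, Set.ncard_coe_finset, Finset.card_range]
  refine ⟨e i, ?_, ?_⟩
  · rw [stableRowWeight, hlen, hA.positiveSet_affinePerm, sInf_generatedSet_dyckGen hD hn]
    exact hA.affinePerm_apply e i
  · simp only [hlen, Equiv.symm_apply_apply]

theorem isAnderson_rowLabel [NeZero n] {D : YoungDiagram} (hmn : Nat.Coprime m n)
    (hD : FitsUnderDiagonal m n D) (hm : 0 < m) {f : Fin n → ℕ}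
    (hf : f ∈ parkingFunctions m n D) :
    IsAnderson m n ((isResidueSystem_dyckGen (D := D) hmn).affinePerm (rowLabel f)) f := by
  have h := isAnderson_affinePerm (D := D) hmn hD hm (rowLabel f)
  rwa [← eq_comp_symm_rowLabel hD hf] at h

theorem positiveSet_eq_of_isAnderson [NeZero n] {D : YoungDiagram} (hω : IsStable m n ω)
    (hmn : Nat.Coprime m n) (hD : FitsUnderDiagonal m n D) {f : Fin n → ℕ}
    (hf : f ∈ parkingFunctions m n D) (h : IsAnderson m n ω f) :
    positiveSet ω = generatedSet (dyckGen m n D) := by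
  rw [hω.eq_affinePerm_of_isAnderson hmn hD hf h]
  exact (isResidueSystem_dyckGen hmn).positiveSet_affinePerm _

theorem isStable_affinePerm_dyckGen [NeZero n] {D : YoungDiagram} (hmn : Nat.Coprime m n)
    (hD : FitsUnderDiagonal m n D) (hm : 0 < m) {e : Equiv.Perm (Fin n)}
    (he : IsAdmissible m (dyckGen m n D) e) :
    IsStable m n ((isResidueSystem_dyckGen (D := D) hmn).affinePerm e) :=
  (isResidueSystem_dyckGen hmn).isStable_affinePerm (sum_dyckGen (NeZero.pos n) hmn)
    (generatedSet_dyckGen_add hD hm) he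

theorem dyckSet_eq [NeZero n] {D : YoungDiagram} (hmn : Nat.Coprime m n)
    (hD : FitsUnderDiagonal m n D) (hm : 0 < m) :
    dyckSet m n D = generatedSet (dyckGen m n D) := by
  have hA := isResidueSystem_dyckGen (D := D) hmn
  ext x
  constructor
  · rintro ⟨ω, hω, ⟨f, hf, h⟩, hx⟩
    rwa [positiveSet_eq_of_isAnderson hω hmn hD hf h] at hx
  · intro hx
    have he := isAdmissible_sort (A := dyckGen m n D) hm
    refine ⟨_, isStable_affinePerm_dyckGen hmn hD hm he,
      ⟨_, comp_symm_mem_parkingFunctions hmn hD hm he, isAnderson_affinePerm hmn hD hm _⟩, ?_⟩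
    rwa [hA.positiveSet_affinePerm]

/-- The choice in `dinv` is immaterial because the parking function determines ω. -/
theorem dinv_eq [NeZero n] {D : YoungDiagram} (hmn : Nat.Coprime m n)
    (hD : FitsUnderDiagonal m n D) (hm : 0 < m) {f : Fin n → ℕ}
    (hf : f ∈ parkingFunctions m n D) :
    dinv m n f =
      dinvPerm m n ((isResidueSystem_dyckGen (D := D) hmn).affinePerm (rowLabel f)) := by
  have h : ∃ ω, IsStable m n ω ∧ IsAnderson m n ω f :=
    ⟨_, isStable_affinePerm_dyckGen hmn hD hm (isAdmissible_rowLabel hmn hD hm hf),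
      isAnderson_rowLabel hmn hD hm hf⟩
  rw [dinv, dif_pos h,
    h.choose_spec.1.eq_affinePerm_of_isAnderson hmn hD hf h.choose_spec.2]

/-- The series of a Dyck path as a sum over admissible permutations of the generators. -/
theorem dyckSeries_eq [NeZero n] {D : YoungDiagram} (hmn : Nat.Coprime m n)
    (hD : FitsUnderDiagonal m n D) (hm : 0 < m) :
    dyckSeries m n D = ∑ᶠ e ∈ {e | IsAdmissible m (dyckGen m n D) e},
      tpow (dinvPerm m n ((isResidueSystem_dyckGen (D := D) hmn).affinePerm e)) •
        fundamental n (descents fun k => dyckGen m n D (e.symm k)) := by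
  refine finsum_mem_eq_of_bijOn rowLabel (bijOn_rowLabel hmn hD hm) fun f hf => ?_
  rw [dinv_eq hmn hD hm hf, ides_eq hmn hD hf]

end Anderson

/-! ### Standard ribbon tableaux as chains of diagrams -/

theorem RibbonStep.unique {m : ℕ} (hm : 0 < m) {κ κ₁ κ₂ : YoungDiagram} {a : ℤ}
    (h₁ : RibbonStep m κ κ₁ a) (h₂ : RibbonStep m κ κ₂ a) : κ₁ = κ₂ := by
  apply mayaSet_injective
  ext x
  rw [(h₁.mem_mayaSet_iff hm).2.2, (h₂.mem_mayaSet_iff hm).2.2]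

theorem monotone_chain {N : ℕ} {κ : ℕ → YoungDiagram} (h : ∀ k < N, κ k ≤ κ (k + 1)) {i j : ℕ}
    (hij : i ≤ j) (hj : j ≤ N) : κ i ≤ κ j := by
  induction j, hij using Nat.le_induction with
  | base => exact le_rfl
  | succ j _ ih => exact (ih (by omega)).trans (h j (by omega))

theorem cells_chain {N : ℕ} {κ : ℕ → YoungDiagram} (h : ∀ k < N, κ k ≤ κ (k + 1)) {k : ℕ}
    (hk : k ≤ N) : (κ k).cells = (κ 0).cells ∪
      (Finset.univ.filter fun i : Fin N => (i : ℕ) < k).biUnion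
        fun i => (κ (i + 1)).cells \ (κ i).cells := by
  induction k with
  | zero => simp
  | succ k ih =>
    have h1 : (Finset.univ.filter fun i : Fin N => (i : ℕ) < k + 1) =
        insert ⟨k, hk⟩ (Finset.univ.filter fun i : Fin N => (i : ℕ) < k) := by
      ext i
      simp only [Finset.mem_filter, Finset.mem_univ, true_and, Finset.mem_insert, Fin.ext_iff]
      omega
    have h2 := YoungDiagram.cells_subset_iff.2 (h k hk)
    rw [h1, Finset.biUnion_insert, ← Finset.union_assoc, Finset.union_comm (κ 0).cells,
      Finset.union_assoc, ← ih (by omega), Finset.sdiff_union_of_subset h2]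

/-- The standard ribbon tableau given by a chain of diagrams that differ by ribbons. -/
def StandardRibbonTableau.ofChain {m : ℕ} (hm : 0 < m) {lam mu : YoungDiagram} (N : ℕ)
    (κ : ℕ → YoungDiagram) (a : Fin N → ℤ) (h0 : κ 0 = lam) (hN : κ N = mu)
    (h : ∀ k : Fin N, RibbonStep m (κ k) (κ (k + 1)) (a k)) : StandardRibbonTableau m lam mu where
  size := N
  ribbon i := (κ (i + 1)).cells \ (κ i).cells
  isRibbon i := (h i).isRibbon hm
  disjoint := by
    have hle : ∀ k < N, κ k ≤ κ (k + 1) := fun k hk => (h ⟨k, hk⟩).le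
    have key : ∀ i j : Fin N, i < j →
        Disjoint ((κ (i + 1)).cells \ (κ i).cells) ((κ (j + 1)).cells \ (κ j).cells) := by
      intro i j hij
      have h1 := YoungDiagram.cells_subset_iff.2
        (monotone_chain hle (i := i + 1) (j := j) hij j.isLt.le)
      exact Finset.disjoint_of_subset_left (Finset.sdiff_subset.trans h1) Finset.disjoint_sdiff
    intro i j hij
    rcases lt_or_gt_of_ne hij with h1 | h1
    · exact key i j h1
    · exact (key j i h1).symm
  cover := by
    have hle : ∀ k < N, κ k ≤ κ (k + 1) := fun k hk => (h ⟨k, hk⟩).le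
    rw [← hN, cells_chain hle le_rfl, ← h0, Finset.union_sdiff_cancel_left]
    · congr 1
      ext i
      simp
    · rw [Finset.disjoint_biUnion_right]
      intro i _
      have h1 := YoungDiagram.cells_subset_iff.2
        (monotone_chain hle (Nat.zero_le i) i.isLt.le)
      exact Finset.disjoint_of_subset_left h1 Finset.disjoint_sdiff
  young k hk := by
    have hle : ∀ k < N, κ k ≤ κ (k + 1) := fun k hk => (h ⟨k, hk⟩).le
    exact ⟨κ k, by rw [cells_chain hle hk, h0]⟩

theorem StandardRibbonTableau.ext_ribbon {m : ℕ} {lam mu : YoungDiagram}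
    {T T' : StandardRibbonTableau m lam mu} (hs : T.size = T'.size)
    (h : ∀ k (h1 : k < T.size) (h2 : k < T'.size), T.ribbon ⟨k, h1⟩ = T'.ribbon ⟨k, h2⟩) :
    T = T' := by
  obtain ⟨N, r, _, _, _, _⟩ := T
  obtain ⟨N', r', _, _, _, _⟩ := T'
  simp only at hs
  subst hs
  have : r = r' := funext fun k => h k k.isLt k.isLt
  subst this
  rfl

/-- A standard ribbon tableau comes from a chain of diagrams that differ by ribbons. -/
theorem StandardRibbonTableau.exists_chain {m : ℕ} (hm : 0 < m) {lam mu : YoungDiagram}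
    (hle : lam ≤ mu) (T : StandardRibbonTableau m lam mu) :
    ∃ κ : ℕ → YoungDiagram, κ 0 = lam ∧ κ T.size = mu ∧ ∀ i : Fin T.size,
      T.ribbon i = (κ (i + 1)).cells \ (κ i).cells ∧
        RibbonStep m (κ i) (κ (i + 1)) (T.contents i + 1) := by
  have hy : ∀ k, ∃ κ : YoungDiagram, k ≤ T.size → κ.cells =
      lam.cells ∪ (Finset.univ.filter fun i : Fin T.size => (i : ℕ) < k).biUnion T.ribbon := by
    intro k
    by_cases hk : k ≤ T.size
    · obtain ⟨κ, hκ⟩ := T.young k hk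
      exact ⟨κ, fun _ => hκ⟩
    · exact ⟨⊥, fun h => absurd h hk⟩
  choose κ hκ using hy
  have hlam : ∀ i, Disjoint lam.cells (T.ribbon i) := by
    intro i
    have h1 : T.ribbon i ⊆ mu.cells \ lam.cells := by
      rw [← T.cover]
      exact Finset.subset_biUnion_of_mem T.ribbon (Finset.mem_univ i)
    exact Finset.disjoint_of_subset_right h1 Finset.disjoint_sdiff
  have hstep : ∀ i : Fin T.size, T.ribbon i = (κ (i + 1)).cells \ (κ i).cells ∧
      κ i ≤ κ (i + 1) := by
    intro i
    have h1 : (Finset.univ.filter fun j : Fin T.size => (j : ℕ) < i + 1) =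
        insert i (Finset.univ.filter fun j : Fin T.size => (j : ℕ) < i) := by
      ext j
      simp only [Finset.mem_filter, Finset.mem_univ, true_and, Finset.mem_insert, Fin.ext_iff]
      omega
    have h2 : (κ (i + 1)).cells = T.ribbon i ∪ (κ i).cells := by
      rw [hκ (i + 1) i.isLt, hκ i i.isLt.le, h1, Finset.biUnion_insert]
      exact Finset.union_left_comm _ _ _
    have h3 : Disjoint (T.ribbon i) (κ i).cells := by
      rw [hκ i i.isLt.le, Finset.disjoint_union_right, Finset.disjoint_biUnion_right]
      refine ⟨(hlam i).symm, fun j hj => T.disjoint i j ?_⟩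
      rintro rfl
      simp at hj
    refine ⟨?_, YoungDiagram.cells_subset_iff.1 (by rw [h2]; exact Finset.subset_union_right)⟩
    rw [h2, Finset.union_sdiff_cancel_right h3]
  refine ⟨κ, ?_, ?_, fun i => ⟨(hstep i).1, ?_⟩⟩
  · ext1
    rw [hκ 0 (Nat.zero_le _)]
    simp
  · ext1
    rw [hκ _ le_rfl]
    have h1 : (Finset.univ.filter fun j : Fin T.size => (j : ℕ) < T.size) = Finset.univ := by
      ext j
      simp
    rw [h1, T.cover, Finset.union_sdiff_of_subset (YoungDiagram.cells_subset_iff.2 hle)]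
  · have h1 := T.isRibbon i
    rw [(hstep i).1] at h1
    obtain ⟨a, ha⟩ := h1.exists_ribbonStep hm (hstep i).2
    have h2 : T.contents i = a - 1 := by
      rw [StandardRibbonTableau.contents, (hstep i).1, ha.ribbonContent_eq hm]
    rwa [h2, sub_add_cancel]

/-- A standard ribbon tableau is determined by its contents. -/
theorem StandardRibbonTableau.ext_contents {m : ℕ} (hm : 0 < m) {lam mu : YoungDiagram}
    (hle : lam ≤ mu) {T T' : StandardRibbonTableau m lam mu} (hs : T.size = T'.size)
    (h : ∀ k (h1 : k < T.size) (h2 : k < T'.size), T.contents ⟨k, h1⟩ = T'.contents ⟨k, h2⟩) :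
    T = T' := by
  obtain ⟨κ, h0, -, hκ⟩ := T.exists_chain hm hle
  obtain ⟨κ', h0', -, hκ'⟩ := T'.exists_chain hm hle
  have heq : ∀ k ≤ T.size, κ k = κ' k := by
    intro k
    induction k with
    | zero => intro _; rw [h0, h0']
    | succ k ih =>
      intro hk
      have h1 := (hκ ⟨k, hk⟩).2
      have h2 := (hκ' ⟨k, hs ▸ hk⟩).2
      rw [← h k hk (hs ▸ hk)] at h2
      simp only at h1 h2
      rw [← ih (by omega)] at h2
      exact h1.unique hm h2
  refine ext_ribbon hs fun k h1 h2 => ?_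
  rw [(hκ _).1, (hκ' _).1]
  simp only
  rw [heq k h1.le, heq (k + 1) h1]

/-! ### The multiset of ribbon contents depends only on the shape -/

open Classical in
theorem RibbonStep.indicator {m : ℕ} (hm : 0 < m) {κ κ' : YoungDiagram} {a : ℤ}
    (h : RibbonStep m κ κ' a) (x : ℤ) :
    (if x ∈ mayaSet κ' then (1 : ℤ) else 0) = (if x ∈ mayaSet κ then 1 else 0) +
      ((if a = x + m then 1 else 0) - if a = x then 1 else 0) := by
  obtain ⟨h1, h2, h3⟩ := h.mem_mayaSet_iff hm
  have h4 := h3 x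
  split_ifs <;> grind

-- Telescoping along the chain: a move from `x + m` fills the place `x`, and a move from `x` empties
-- it.
open Classical in
theorem StandardRibbonTableau.sum_indicator {m : ℕ} (hm : 0 < m) {lam mu : YoungDiagram}
    (hle : lam ≤ mu) (T : StandardRibbonTableau m lam mu) (x : ℤ) :
    (∑ k, if T.contents k + 1 = x + m then (1 : ℤ) else 0) -
        (∑ k, if T.contents k + 1 = x then 1 else 0) =
      (if x ∈ mayaSet mu then 1 else 0) - if x ∈ mayaSet lam then 1 else 0 := by
  obtain ⟨κ, h0, hN, hκ⟩ := T.exists_chain hm hle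
  have htel := Finset.sum_range_sub (fun k => if x ∈ mayaSet (κ k) then (1 : ℤ) else 0) T.size
  simp only [h0, hN] at htel
  rw [← Finset.sum_sub_distrib, ← htel, Finset.sum_range]
  refine Finset.sum_congr rfl fun k _ => ?_
  rw [(hκ k).2.indicator hm x]
  ring

theorem eq_zero_of_periodic {m : ℕ} (hm : 0 < m) {h : ℤ → ℤ} (hper : ∀ x, h (x + m) = h x)
    {B : ℤ} (hB : ∀ x > B, h x = 0) (x : ℤ) : h x = 0 := by
  have h1 : ∀ k : ℕ, h (x + m * k) = h x := by
    intro k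
    induction k with
    | zero => simp
    | succ k ih =>
      rw [← ih, ← hper (x + m * k)]
      congr 1
      push_cast
      ring
  rw [← h1 (B - x + 1).toNat]
  apply hB
  have h2 : ((B - x + 1).toNat : ℤ) ≤ m * (B - x + 1).toNat :=
    le_mul_of_one_le_left (by positivity) (by exact_mod_cast hm)
  omega

/-- The contents of the ribbons, as a multiset, depend only on the shape. -/
theorem StandardRibbonTableau.sum_contents_eq {m : ℕ} (hm : 0 < m) {lam mu : YoungDiagram}
    (hle : lam ≤ mu) (T T' : StandardRibbonTableau m lam mu) (x : ℤ) :
    (∑ k, if T.contents k + 1 = x then (1 : ℤ) else 0) =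
      ∑ k, if T'.contents k + 1 = x then 1 else 0 := by
  -- The difference of the two counts is `m`-periodic, because its increment from `x` to `x + m`
  -- depends only on the shape, and it vanishes for large `x`.
  rw [← sub_eq_zero]
  refine eq_zero_of_periodic hm
    (h := fun x => (∑ k, if T.contents k + 1 = x then (1 : ℤ) else 0) -
      ∑ k, if T'.contents k + 1 = x then 1 else 0)
    (B := ∑ k, |T.contents k + 1| + ∑ k, |T'.contents k + 1|) ?_ ?_ x
  · intro x
    have h1 := T.sum_indicator hm hle x
    have h2 := T'.sum_indicator hm hle x
    linarith
  · intro x hx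
    have hz : ∀ {N : ℕ} (a : Fin N → ℤ), ∑ k, |a k| < x →
        (∑ k, if a k = x then (1 : ℤ) else 0) = 0 := by
      intro N a ha
      refine Finset.sum_eq_zero fun k _ => if_neg ?_
      rintro rfl
      have h1 := Finset.single_le_sum (f := fun k => |a k|) (fun _ _ => abs_nonneg _)
        (Finset.mem_univ k)
      have h2 := le_abs_self (a k)
      omega
    have h1 : 0 ≤ ∑ k, |T.contents k + 1| := Finset.sum_nonneg fun _ _ => abs_nonneg _
    have h2 : 0 ≤ ∑ k, |T'.contents k + 1| := Finset.sum_nonneg fun _ _ => abs_nonneg _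
    rw [hz _ (by omega), hz _ (by omega), sub_zero]

/-! ### Standard ribbon tableaux and admissible permutations -/

section Moved

variable {m n : ℕ} {A : Fin n → ℤ} {e : Equiv.Perm (Fin n)}

theorem mem_movedSet (hA : Function.Injective A) (k : Fin n) :
    A (e.symm k) ∈ movedSet m A e k := by
  refine Or.inl ⟨mem_generatedSet A _, ?_⟩
  rintro ⟨j, hj, h⟩
  rw [hA hj, Equiv.apply_symm_apply] at h
  exact lt_irrefl _ h

/-- The target of the move is free: if it belonged to the original set, it was a generator that
admissibility has already moved. -/
theorem IsResidueSystem.sub_notMem_movedSet [NeZero n] (hA : IsResidueSystem A)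
    (hm : ∀ x ∈ generatedSet A, x + m ∈ generatedSet A) (he : IsAdmissible m A e) (k : Fin n) :
    A (e.symm k) - m ∉ movedSet m A e k := by
  rintro (⟨h1, h2⟩ | ⟨j, hj, h⟩)
  · obtain ⟨i, hi⟩ := hA.eq_of_add_eq_mem hm h1
    have h3 := he _ _ hi
    rw [Equiv.apply_symm_apply] at h3
    exact h2 ⟨i, by omega, h3⟩
  · rw [hA.injective (sub_left_injective hj), Equiv.apply_symm_apply] at h
    exact lt_irrefl _ h

theorem mem_movedSet_succ (he : IsAdmissible m A e) (k : Fin n) (x : ℤ) :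
    x ∈ movedSet m A e (k + 1) ↔
      x = A (e.symm k) - m ∨ (x ∈ movedSet m A e k ∧ x ≠ A (e.symm k)) := by
  have hk : ∀ j, (e j : ℕ) < k + 1 → (e j : ℕ) < k ∨ j = e.symm k := by
    intro j hj
    rcases Nat.lt_succ_iff_lt_or_eq.1 hj with h | h
    · exact Or.inl h
    · right
      rw [Equiv.eq_symm_apply]
      exact Fin.ext h
  constructor
  · rintro (⟨h1, h2⟩ | ⟨j, rfl, h⟩)
    · refine Or.inr ⟨Or.inl ⟨h1, ?_⟩, ?_⟩
      · rintro ⟨j, hj, h⟩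
        exact h2 ⟨j, hj, by omega⟩
      · rintro rfl
        exact h2 ⟨_, rfl, by simp⟩
    · rcases hk j h with h1 | rfl
      · refine Or.inr ⟨Or.inr ⟨j, rfl, h1⟩, fun h2 => ?_⟩
        -- A place filled earlier is not the generator now leaving: `A j - m = A (e.symm k)` would
        -- force `j` to move later.
        have h3 := he (e.symm k) j (by omega)
        rw [Equiv.apply_symm_apply, Fin.lt_def] at h3
        omega
      · exact Or.inl rfl
  · rintro (rfl | ⟨⟨h1, h2⟩ | ⟨j, rfl, h⟩, h3⟩)
    · exact Or.inr ⟨_, rfl, by simp⟩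
    · refine Or.inl ⟨h1, ?_⟩
      rintro ⟨j, hj, h⟩
      rcases hk j h with h4 | rfl
      · exact h2 ⟨j, hj, h4⟩
      · exact h3 hj.symm
    · exact Or.inr ⟨j, rfl, by omega⟩

/-- The diagrams obtained by moving the generators one after the other. -/
def movedDiagram (m : ℕ) {n : ℕ} (A : Fin n → ℤ) (e : Equiv.Perm (Fin n)) (k : ℕ) :
    YoungDiagram := Function.invFun mayaSet (movedSet m A e k)

theorem invFun_mayaSet (κ : YoungDiagram) : Function.invFun mayaSet (mayaSet κ) = κ :=
  Function.leftInverse_invFun mayaSet_injective κ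

/-- `Function.invFun` returns a genuine preimage at every stage: each moved set is the Maya set of
the diagram produced by the preceding ribbon step. -/
theorem IsResidueSystem.mayaSet_movedDiagram [NeZero n] (hA : IsResidueSystem A)
    (hm : ∀ x ∈ generatedSet A, x + m ∈ generatedSet A) (hm0 : 0 < m) (he : IsAdmissible m A e)
    {lam : YoungDiagram} (hlam : mayaSet lam = generatedSet A) :
    ∀ k ≤ n, mayaSet (movedDiagram m A e k) = movedSet m A e k ∧ ∀ hk : k < n,
      RibbonStep m (movedDiagram m A e k) (movedDiagram m A e (k + 1)) (A (e.symm ⟨k, hk⟩)) := by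
  have key : ∀ k, ∀ hk : k < n, mayaSet (movedDiagram m A e k) = movedSet m A e k →
      RibbonStep m (movedDiagram m A e k) (movedDiagram m A e (k + 1)) (A (e.symm ⟨k, hk⟩)) ∧
        mayaSet (movedDiagram m A e (k + 1)) = movedSet m A e (k + 1) := by
    intro k hk h
    obtain ⟨κ', hκ'⟩ := exists_ribbonStep (κ := movedDiagram m A e k)
      (a := A (e.symm ⟨k, hk⟩)) hm0
      (by rw [h]; exact mem_movedSet hA.injective ⟨k, hk⟩)
      (by rw [h]; exact hA.sub_notMem_movedSet hm he ⟨k, hk⟩)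
    have h1 : mayaSet κ' = movedSet m A e (k + 1) := by
      ext x
      rw [(hκ'.mem_mayaSet_iff hm0).2.2, h]
      exact (mem_movedSet_succ he ⟨k, hk⟩ x).symm
    have h2 : movedDiagram m A e (k + 1) = κ' := by
      rw [movedDiagram, ← h1, invFun_mayaSet]
    rw [h2]
    exact ⟨hκ', h1⟩
  have h0 : ∀ k ≤ n, mayaSet (movedDiagram m A e k) = movedSet m A e k := by
    intro k
    induction k with
    | zero =>
      intro _
      rw [movedDiagram, movedSet_zero, ← hlam, invFun_mayaSet]
    | succ k ih =>
      intro hk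
      exact (key k hk (ih (by omega))).2
  exact fun k hk => ⟨h0 k hk, fun hk' => (key k hk' (h0 k hk)).1⟩

variable [NeZero n] (hA : IsResidueSystem A)
  (hm : ∀ x ∈ generatedSet A, x + m ∈ generatedSet A) (hm0 : 0 < m)
  {lam mu : YoungDiagram} (hlam : mayaSet lam = generatedSet A)
  (hmu : mayaSet mu = jumpSet m n (generatedSet A))

/-- The standard ribbon tableau of an admissible permutation of the generators. -/
def IsResidueSystem.tableau (he : IsAdmissible m A e) : StandardRibbonTableau m lam mu :=
  StandardRibbonTableau.ofChain hm0 n (movedDiagram m A e) (fun k => A (e.symm k))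
    (by rw [movedDiagram, movedSet_zero, ← hlam, invFun_mayaSet])
    (by rw [movedDiagram, hA.movedSet_self, ← hmu, invFun_mayaSet])
    fun k => (hA.mayaSet_movedDiagram hm hm0 he hlam k k.isLt.le).2 k.isLt

theorem IsResidueSystem.contents_tableau (he : IsAdmissible m A e) :
    (hA.tableau hm hm0 hlam hmu he).contents = fun k : Fin n => A (e.symm k) - 1 :=
  funext fun k : Fin n =>
    ((hA.mayaSet_movedDiagram hm hm0 he hlam k k.isLt.le).2 k.isLt).ribbonContent_eq hm0

theorem IsResidueSystem.spin_tableau (he : IsAdmissible m A e) :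
    (hA.tableau hm hm0 hlam hmu he).spin =
      generatorGaps m A + 2 * generatorInversions m A e := by
  classical
  rw [← hA.sum_card_movedSet hm he]
  refine Finset.sum_congr rfl fun k _ => ?_
  have h := hA.mayaSet_movedDiagram hm hm0 he hlam k (show (k : ℕ) < n from k.isLt).le
  rw [← h.1]
  refine ((h.2 k.isLt).ribbonSpin_eq hm0).trans ?_
  congr

include hA hm hm0 hlam hmu in
theorem IsResidueSystem.le_of_mayaSet : lam ≤ mu := by
  have he := isAdmissible_sort (A := A) hm0
  have h0 : movedDiagram m A (Tuple.sort A).symm 0 = lam := by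
    rw [movedDiagram, movedSet_zero, ← hlam, invFun_mayaSet]
  have h1 : movedDiagram m A (Tuple.sort A).symm n = mu := by
    rw [movedDiagram, hA.movedSet_self, ← hmu, invFun_mayaSet]
  rw [← h0, ← h1]
  exact monotone_chain
    (fun k hk => ((hA.mayaSet_movedDiagram hm hm0 he hlam k hk.le).2 hk).le) (Nat.zero_le n) le_rfl

include hA hm hm0 hlam hmu in
-- Contents can be read off from any one tableau of the shape; the tableau of the increasing order
-- shows that every generator moves exactly once.
theorem IsResidueSystem.sum_contents (T : StandardRibbonTableau m lam mu) (x : ℤ) :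
    (∑ k, if T.contents k + 1 = x then (1 : ℤ) else 0) = ∑ i, if A i = x then 1 else 0 := by
  have he := isAdmissible_sort (A := A) hm0
  rw [T.sum_contents_eq hm0 (hA.le_of_mayaSet hm hm0 hlam hmu)
    (hA.tableau hm hm0 hlam hmu he), hA.contents_tableau hm hm0 hlam hmu he]
  simp only [sub_add_cancel]
  exact Equiv.sum_comp (Tuple.sort A).symm.symm fun i => if A i = x then (1 : ℤ) else 0

include hA hm hm0 hlam hmu in
theorem IsResidueSystem.contents_injective (T : StandardRibbonTableau m lam mu) :
    Function.Injective T.contents := by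
  intro k l hkl
  by_contra hne
  have h := hA.sum_contents hm hm0 hlam hmu T (T.contents k + 1)
  have h1 : (∑ i, if A i = T.contents k + 1 then (1 : ℤ) else 0) ≤ 1 := by
    rw [Finset.sum_boole]
    norm_cast
    rw [Finset.card_le_one]
    intro i hi j hj
    rw [Finset.mem_filter] at hi hj
    exact hA.injective (hi.2.trans hj.2.symm)
  rw [← h, Finset.sum_boole] at h1
  norm_cast at h1
  rw [Finset.card_le_one] at h1
  exact hne (h1 k (by simp) l (by simp [hkl]))

include hA hm hm0 hlam hmu in
theorem IsResidueSystem.range_contents (T : StandardRibbonTableau m lam mu) :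
    Set.range (fun k => T.contents k + 1) = Set.range A := by
  have hpos : ∀ {N : ℕ} (a : Fin N → ℤ) (x : ℤ),
      x ∈ Set.range a ↔ 0 < ∑ k, if a k = x then (1 : ℤ) else 0 := by
    intro N a x
    rw [Finset.sum_boole, Nat.cast_pos, Finset.card_pos]
    simp [Finset.filter_nonempty_iff]
  ext x
  rw [hpos, hpos, hA.sum_contents hm hm0 hlam hmu T]

include hA hm hm0 hlam hmu in
-- The order in which the generators move is the required permutation. It is admissible because a
-- generator `A i` that has not moved yet blocks the move of `A i + m`.
theorem IsResidueSystem.exists_tableau_eq (T : StandardRibbonTableau m lam mu) :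
    ∃ (e : Equiv.Perm (Fin n)) (he : IsAdmissible m A e),
      hA.tableau hm hm0 hlam hmu he = T := by
  have hle := hA.le_of_mayaSet hm hm0 hlam hmu
  have hinj := hA.contents_injective hm hm0 hlam hmu T
  have hrange := hA.range_contents hm hm0 hlam hmu T
  have hk : ∀ i, ∃ k, T.contents k + 1 = A i := by
    intro i
    have : A i ∈ Set.range (fun k => T.contents k + 1) := by
      rw [hrange]
      exact ⟨i, rfl⟩
    exact this
  choose k hk using hk
  have hbij : Function.Bijective k := by
    constructor
    · intro i j hij
      apply hA.injective
      rw [← hk, ← hk, hij]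
    · intro l
      have : T.contents l + 1 ∈ Set.range A := by
        rw [← hrange]
        exact ⟨l, rfl⟩
      obtain ⟨i, hi⟩ := this
      refine ⟨i, hinj ?_⟩
      have := hk i
      omega
  have hsize : n = T.size := by
    have := Fintype.card_of_bijective hbij
    simpa using this
  let e : Equiv.Perm (Fin n) := (Equiv.ofBijective k hbij).trans (finCongr hsize.symm)
  have hek : ∀ i, (e i : ℕ) = k i := fun i => rfl
  have he : IsAdmissible m A e := by
    intro i j hij
    rw [Fin.lt_def, hek, hek]
    obtain ⟨κ, h0, -, hκ⟩ := T.exists_chain hm0 hle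
    by_contra! hlt
    -- `A i` stays occupied until its own move, contradicting that `A j - m` is free when `A j`
    -- moves.
    have h1 : ∀ t ≤ (k j : ℕ), A i ∈ mayaSet (κ t) := by
      intro t
      induction t with
      | zero =>
        intro _
        rw [h0, hlam]
        exact mem_generatedSet A i
      | succ t ih =>
        intro ht
        have ht' : t < T.size := by omega
        have h2 := (hκ ⟨t, ht'⟩).2
        refine ((h2.mem_mayaSet_iff hm0).2.2 _).2 (Or.inr ⟨ih (by omega), ?_⟩)
        rw [← hk]
        intro h3
        have h4 := congrArg Fin.val (hinj (add_left_injective 1 h3))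
        simp only at h4
        omega
    have h2 := ((hκ (k j)).2.mem_mayaSet_iff hm0).2.1
    rw [hk, hij, add_sub_cancel_right] at h2
    exact h2 (h1 _ le_rfl)
  refine ⟨e, he, ?_⟩
  refine StandardRibbonTableau.ext_contents hm0 hle hsize fun l h1 h2 => ?_
  have h3 : (hA.tableau hm hm0 hlam hmu he).contents ⟨l, h1⟩ = A (e.symm ⟨l, h1⟩) - 1 :=
    congrFun (hA.contents_tableau hm hm0 hlam hmu he) ⟨l, h1⟩
  rw [h3, ← hk, add_sub_cancel_right]
  congr 1
  apply Fin.ext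
  rw [← hek, Equiv.apply_symm_apply]

theorem IsResidueSystem.tableau_bijective : Function.Bijective
    fun e : {e | IsAdmissible m A e} => hA.tableau hm hm0 hlam hmu e.2 := by
  constructor
  · rintro ⟨e, he⟩ ⟨e', he'⟩ h
    have key : ∀ T T' : StandardRibbonTableau m lam mu, T = T' →
        ∀ k (h1 : k < T.size) (h2 : k < T'.size), T.contents ⟨k, h1⟩ = T'.contents ⟨k, h2⟩ := by
      rintro T _ rfl k _ _
      rfl
    have h1 := key _ _ h
    apply Subtype.ext
    apply Equiv.symm_bijective.1
    ext k
    have h2 : A (e.symm k) - 1 = A (e'.symm k) - 1 := by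
      have h3 := h1 k k.isLt k.isLt
      simp only [hA.contents_tableau] at h3
      exact h3
    exact congrArg Fin.val (hA.injective (sub_left_injective h2))
  · intro T
    obtain ⟨e, he, h⟩ := hA.exists_tableau_eq hm hm0 hlam hmu T
    exact ⟨⟨e, he⟩, h⟩

include hA hm hm0 hlam hmu in
/-- The sum over standard ribbon tableaux as a sum over admissible permutations. -/
theorem IsResidueSystem.finsum_tableau :
    (∑ᶠ T : StandardRibbonTableau m lam mu,
      tpow (-(T.spin : ℚ) / 2) • fundamental T.size (descents T.contents)) =
    ∑ᶠ e ∈ {e | IsAdmissible m A e},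
      tpow (-((generatorGaps m A + 2 * generatorInversions m A e : ℕ) : ℚ) / 2) •
        fundamental n (descents fun k => A (e.symm k)) := by
  rw [← finsum_set_coe_eq_finsum_mem]
  symm
  refine finsum_eq_of_bijective _ (hA.tableau_bijective hm hm0 hlam hmu) ?_
  rintro ⟨e, he⟩
  simp only
  rw [hA.spin_tableau, hA.contents_tableau]
  congr 2
  ext k
  simp only [descents, sub_lt_sub_iff_right]
  rfl

end Moved

/-! ### The core of a Dyck path -/

theorem ediv_add_one_of_not_dvd {n : ℤ} (hn : 0 < n) {a : ℤ} (h : ¬ n ∣ a + 1) :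
    (a + 1) / n = a / n := by
  rw [Int.ediv_eq_iff_of_pos hn]
  have h1 := Int.emod_add_mul_ediv a n
  have h2 := Int.emod_nonneg a hn.ne'
  have h3 := Int.emod_lt_of_pos a hn
  have h4 : a % n + 1 ≠ n := by
    intro h4
    exact h ⟨a / n + 1, by linear_combination -h1 + h4⟩
  constructor <;> nlinarith [lt_of_le_of_ne (Int.add_one_le_iff.2 h3) h4]

-- Counting the elements up to `c` class by class gives `R`. That `R c = c` for large `c` is exactly
-- the condition that the generators sum to `1 + ... + n`.
open Classical in
theorem IsResidueSystem.exists_mayaSet_eq {n : ℕ} [NeZero n] {A : Fin n → ℤ}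
    (hA : IsResidueSystem A) (hsum : ∑ i, A i = (n : ℤ) * (n + 1) / 2) :
    ∃ κ : YoungDiagram, mayaSet κ = generatedSet A := by
  have hn : 0 < (n : ℤ) := by exact_mod_cast NeZero.pos n
  let R : ℤ → ℕ := fun c => ∑ i, ((c - A i) / n + 1).toNat
  have hR : ∀ c, R (c + 1) = R c + if c + 1 ∈ generatedSet A then 1 else 0 := by
    intro c
    obtain ⟨i, q, hc⟩ := hA.exists_eq_add (c + 1)
    have h1 : ∀ j, (((c + 1 - A j) / n + 1).toNat : ℤ) = ((c - A j) / n + 1).toNat +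
        if j = i then (if c + 1 ∈ generatedSet A then 1 else 0) else 0 := by
      intro j
      by_cases hj : j = i
      · subst hj
        have e1 : (c + 1 - A j) / n = q := by
          rw [hc, add_sub_cancel_left, Int.mul_ediv_cancel_left _ hn.ne']
        have e2 : (c - A j) / n = q - 1 := by
          rw [Int.ediv_eq_iff_of_pos hn]
          constructor <;> nlinarith
        rw [e1, e2, if_pos rfl, hc]
        simp only [hA.add_mul_mem_iff]
        split_ifs <;> omega
      · rw [if_neg hj, add_zero]
        have e1 : (c + 1 - A j) / n = (c - A j) / n := by
          have h2 : ¬ (n : ℤ) ∣ c - A j + 1 := by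
            intro h2
            apply hj
            symm
            apply hA
            have : A i - A j = c - A j + 1 - n * q := by linarith
            rw [this]
            exact dvd_sub h2 (dvd_mul_right _ _)
          rw [show c + 1 - A j = c - A j + 1 by ring]
          exact ediv_add_one_of_not_dvd hn h2
        rw [e1]
    have h2 : (R (c + 1) : ℤ) = R c + if c + 1 ∈ generatedSet A then 1 else 0 := by
      simp only [R]
      push_cast only [Nat.cast_sum]
      rw [Finset.sum_congr rfl fun j _ => h1 j, Finset.sum_add_distrib]
      simp
    have h3 : ((if c + 1 ∈ generatedSet A then 1 else 0 : ℕ) : ℤ) =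
        if c + 1 ∈ generatedSet A then 1 else 0 := by split_ifs <;> rfl
    rw [← h3] at h2
    exact_mod_cast h2
  have hB : ∀ i, |A i| ≤ ((∑ i, (A i).natAbs : ℕ) : ℤ) := by
    intro i
    rw [Int.abs_eq_natAbs]
    exact_mod_cast Finset.single_le_sum (f := fun i => (A i).natAbs)
      (fun _ _ => Nat.zero_le _) (Finset.mem_univ i)
  obtain ⟨κ, hκ⟩ := exists_diagram_rowCount (R := R) (K := ∑ i, (A i).natAbs + 1)
    (fun c => by rw [hR]; split_ifs <;> simp) (by
      intro c hc
      refine Finset.sum_eq_zero fun i _ => ?_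
      have h1 := (abs_le.1 (hB i)).1
      have h2 : (c - A i) / n < 0 := Int.ediv_neg_of_neg_of_pos (by push_cast at hc h1; omega) hn
      omega) (by
      intro c hc
      have h1 : ∀ i, (((c - A i) / n + 1).toNat : ℤ) = (c - A i) / n + 1 := by
        intro i
        have h1 := (abs_le.1 (hB i)).2
        have h2 : 0 ≤ (c - A i) / n := Int.ediv_nonneg (by push_cast at hc h1; omega) hn.le
        omega
      -- This function has the same sum over the generators as over `c + 1, ..., c + n`, where every
      -- quotient is `-1`.
      have hper : Function.Periodic (fun x : ℤ => (c - x) / n * n + x) (n : ℤ) := by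
        intro x
        simp only
        rw [show c - (x + n) = c - x + n * (-1) by ring, Int.add_mul_ediv_left _ _ hn.ne']
        ring
      have h2 := hA.sum_eq_sum_Icc hper
      rw [← ((isResidueSystem_succ n).sub_const (-c)).sum_eq_sum_Icc hper] at h2
      have h3 : ∀ i : Fin n, (c - ((i : ℤ) + 1 - -c)) / n = -1 := by
        intro i
        rw [Int.ediv_eq_iff_of_pos hn]
        omega
      simp only [h3] at h2
      rw [Finset.sum_add_distrib, hsum, ← sum_fin_add_one, ← Finset.sum_mul] at h2
      have h4 : ∑ i : Fin n, (-1 * (n : ℤ) + ((i : ℤ) + 1 - -c)) =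
          ∑ i : Fin n, ((i : ℤ) + 1) + n * (c - n) := by
        rw [← nsmul_eq_mul, ← Fin.sum_const, ← Finset.sum_add_distrib]
        exact Finset.sum_congr rfl fun i _ => by ring
      rw [h4] at h2
      have h5 : ∑ i, (c - A i) / n = c - n := by
        apply mul_right_cancel₀ hn.ne'
        linarith
      simp only [R]
      push_cast only [Nat.cast_sum]
      rw [Finset.sum_congr rfl fun i _ => h1 i, Finset.sum_add_distrib, h5]
      simp)
  refine ⟨κ, ?_⟩
  ext x
  rw [mem_mayaSet_iff, hκ, hκ]
  have h := hR (x - 1)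
  rw [sub_add_cancel] at h
  rw [h]
  by_cases hx : x ∈ generatedSet A <;> simp [hx]

/-! ### Semistandard ribbon tableaux -/

section Semistandard

variable {m : ℕ} {lam mu : YoungDiagram}

theorem StandardRibbonTableau.ribbon_injective (T : StandardRibbonTableau m lam mu) :
    Function.Injective T.ribbon := by
  intro i j hij
  by_contra hne
  have h1 := T.disjoint i j hne
  rw [hij, disjoint_self] at h1
  exact (T.isRibbon j).nonempty.ne_empty h1

/-- The standard ribbon tableau `T` lists the ribbons of `S` in their total order, and `i` lists
their labels. -/
def IsStandardization (S : SemistandardRibbonTableau m lam mu) (T : StandardRibbonTableau m lam mu)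
    (i : Fin T.size → ℕ+) : Prop :=
  ∃ h : ∀ k, T.ribbon k ∈ S.ribbons,
    (∀ r ∈ S.ribbons, ∃ k, T.ribbon k = r) ∧
    (∀ k l, k < l → RibbonPrec S.label ⟨T.ribbon k, h k⟩ ⟨T.ribbon l, h l⟩) ∧
    ∀ k, i k = S.label ⟨T.ribbon k, h k⟩

theorem exists_isStandardization (S : SemistandardRibbonTableau m lam mu) :
    ∃ p : Σ T : StandardRibbonTableau m lam mu, (Fin T.size → ℕ+),
      IsStandardization S p.1 p.2 := by
  obtain ⟨T, h, h1, h2⟩ := S.standard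
  exact ⟨⟨T, fun k => S.label ⟨T.ribbon k, h k⟩⟩, h, h1, h2, fun _ => rfl⟩

namespace IsStandardization

variable {S S' : SemistandardRibbonTableau m lam mu} {T T' : StandardRibbonTableau m lam mu}
  {i : Fin T.size → ℕ+} {i' : Fin T'.size → ℕ+}

theorem ribbons_eq (h : IsStandardization S T i) : S.ribbons = Finset.univ.image T.ribbon := by
  obtain ⟨h0, h1, -, -⟩ := h
  ext r
  rw [Finset.mem_image]
  constructor
  · intro hr
    obtain ⟨k, hk⟩ := h1 r hr
    exact ⟨k, Finset.mem_univ k, hk⟩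
  · rintro ⟨k, -, rfl⟩
    exact h0 k

theorem eq_left (h : IsStandardization S T i) (h' : IsStandardization S' T i) : S = S' := by
  have hr := h.ribbons_eq.trans h'.ribbons_eq.symm
  obtain ⟨h0, h1, -, h3⟩ := h
  obtain ⟨h0', h1', -, h3'⟩ := h'
  obtain ⟨R, _, _, _, l, _, _⟩ := S
  obtain ⟨R', _, _, _, l', _, _⟩ := S'
  simp only at hr h0 h1 h3 h0' h1' h3'
  subst hr
  have : l = l' := by
    funext ⟨r, hr⟩
    obtain ⟨k, rfl⟩ := h1 r hr
    rw [← h3 k, ← h3' k]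
  subst this
  rfl

theorem size_eq (h : IsStandardization S T i) : T.size = S.ribbons.card := by
  rw [h.ribbons_eq, Finset.card_image_of_injective _ T.ribbon_injective, Finset.card_univ,
    Fintype.card_fin]

/-- Both tableaux list the same ribbons in increasing lexicographic order of label and content, and
a strictly increasing list is determined by its range. -/
theorem eq_right (h : IsStandardization S T i) (h' : IsStandardization S T' i') :
    (⟨T, i⟩ : Σ T : StandardRibbonTableau m lam mu, (Fin T.size → ℕ+)) = ⟨T', i'⟩ := by
  have hs : T.size = T'.size := h.size_eq.trans h'.size_eq.symm
  have hT : T = T' := by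
    obtain ⟨h0, h1, h2, h3⟩ := h
    obtain ⟨h0', h1', h2', h3'⟩ := h'
    obtain ⟨N, r, a1, a2, a3, a4⟩ := T
    obtain ⟨N', r', b1, b2, b3, b4⟩ := T'
    simp only at hs h0 h1 h2 h0' h1' h2'
    subst hs
    let key : {r // r ∈ S.ribbons} → ℕ+ ×ₗ ℤ := fun r => toLex (S.label r, ribbonContent r)
    have hkey : ∀ {r s}, RibbonPrec S.label r s → key r < key s := by
      intro r s hrs
      rw [Prod.Lex.toLex_lt_toLex]
      exact hrs
    have hinj : ∀ r s, key r = key s → r = s := by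
      intro r s hrs
      by_contra hne
      rcases S.total r s hne with h5 | h5
      · exact (hkey h5).ne hrs
      · exact (hkey h5).ne hrs.symm
    have hm1 : StrictMono fun k => key ⟨r k, h0 k⟩ := fun k l hkl => hkey (h2 k l hkl)
    have hm2 : StrictMono fun k => key ⟨r' k, h0' k⟩ := fun k l hkl => hkey (h2' k l hkl)
    have hrange : Set.range (fun k => key ⟨r k, h0 k⟩) = Set.range fun k => key ⟨r' k, h0' k⟩ := by
      apply Set.Subset.antisymm
      · rintro _ ⟨k, rfl⟩
        obtain ⟨l, hl⟩ := h1' _ (h0 k)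
        exact ⟨l, by simp only [hl]⟩
      · rintro _ ⟨k, rfl⟩
        obtain ⟨l, hl⟩ := h1 _ (h0' k)
        exact ⟨l, by simp only [hl]⟩
    have heq := (hm1.range_inj hm2).1 hrange
    have hr : r = r' := by
      funext k
      exact congrArg Subtype.val (hinj _ _ (congrFun heq k))
    subst hr
    rfl
  subst hT
  obtain ⟨h0, -, -, h3⟩ := h
  obtain ⟨h0', -, -, h3'⟩ := h'
  have : i = i' := by
    funext k
    rw [h3, h3']
  rw [this]

theorem spin_eq (h : IsStandardization S T i) : S.spin = T.spin := by
  rw [SemistandardRibbonTableau.spin, h.ribbons_eq,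
    Finset.sum_image fun _ _ _ _ h => T.ribbon_injective h]
  rfl

theorem weight_eq (h : IsStandardization S T i) : S.weight = ∑ a, Finsupp.single (i a) 1 := by
  obtain ⟨h0, h1, -, h3⟩ := h
  symm
  refine Fintype.sum_bijective (fun k => ⟨T.ribbon k, h0 k⟩) ⟨?_, ?_⟩ _ _ fun k => ?_
  · intro k l hkl
    exact T.ribbon_injective (congrArg Subtype.val hkl)
  · rintro ⟨r, hr⟩
    obtain ⟨k, rfl⟩ := h1 r hr
    exact ⟨k, rfl⟩
  · rw [h3]

/-- Ribbons with equal labels are ordered by content, so equal consecutive labels cannot occur at a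
descent. -/
theorem mem_fundamentalIndices (h : IsStandardization S T i) :
    i ∈ fundamentalIndices T.size (descents T.contents) S.weight := by
  refine ⟨?_, ?_, h.weight_eq.symm⟩
  · obtain ⟨h0, -, h2, h3⟩ := h
    intro a b hab
    rcases hab.eq_or_lt with rfl | hab
    · exact le_rfl
    · rw [h3, h3]
      rcases h2 a b hab with h4 | h4
      · exact h4.le
      · exact h4.1.le
  · obtain ⟨h0, -, h2, h3⟩ := h
    rintro a b hab heq ⟨a', b', ha', hb', hlt⟩
    have e1 : a' = a := Fin.ext (by omega)
    have e2 : b' = b := Fin.ext (by omega)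
    subst e1 e2
    rw [h3, h3] at heq
    rcases h2 a' b' (by rw [Fin.lt_def]; omega) with h4 | h4
    · exact h4.ne heq
    · exact absurd h4.2 hlt.not_gt

end IsStandardization

/-- Monotonicity makes all labels in between equal, so there is no descent in between, and distinct
contents increase strictly. -/
theorem contents_lt_of_label_eq {T : StandardRibbonTableau m lam mu}
    (hT : Function.Injective T.contents) {i : Fin T.size → ℕ+} {d : ℕ+ →₀ ℕ}
    (hi : i ∈ fundamentalIndices T.size (descents T.contents) d) (k : Fin T.size) :
    ∀ (c : ℕ) (h : k + (c + 1) < T.size), i k = i ⟨k + (c + 1), h⟩ →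
      T.contents k < T.contents ⟨k + (c + 1), h⟩ := by
  obtain ⟨h1, h2, -⟩ := hi
  have adj : ∀ a b : Fin T.size, (a : ℕ) + 1 = b → i a = i b → T.contents a < T.contents b := by
    intro a b hab heq
    have h3 := h2 a b hab heq
    have h4 : T.contents a ≤ T.contents b := by
      by_contra! h4
      exact h3 ⟨a, b, rfl, hab.symm, h4⟩
    refine lt_of_le_of_ne h4 fun h5 => ?_
    have := hT h5
    subst this
    omega
  intro c
  induction c with
  | zero =>
    intro h heq
    exact adj k _ (by simp) heq
  | succ c ih =>
    intro h heq
    have h3 : k + (c + 1) < T.size := by omega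
    have h4 : i k ≤ i ⟨k + (c + 1), h3⟩ := h1 (by rw [Fin.le_def]; simp)
    have h5 : i ⟨k + (c + 1), h3⟩ ≤ i ⟨k + (c + 1 + 1), h⟩ := h1 (by rw [Fin.le_def]; simp)
    have h6 : i k = i ⟨k + (c + 1), h3⟩ := le_antisymm h4 (h5.trans heq.ge)
    exact (ih h3 h6).trans (adj _ _ (by simp; omega) (h6.symm.trans heq))

theorem exists_isStandardization_of_mem {T : StandardRibbonTableau m lam mu}
    (hT : Function.Injective T.contents) {i : Fin T.size → ℕ+} {d : ℕ+ →₀ ℕ}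
    (hi : i ∈ fundamentalIndices T.size (descents T.contents) d) :
    ∃ S, IsStandardization S T i := by
  have hex : ∀ r : {r // r ∈ Finset.univ.image T.ribbon}, ∃ k, T.ribbon k = r := by
    rintro ⟨r, hr⟩
    obtain ⟨k, -, hk⟩ := Finset.mem_image.1 hr
    exact ⟨k, hk⟩
  choose idx hidx using hex
  have hmem : ∀ k, T.ribbon k ∈ Finset.univ.image T.ribbon := fun k =>
    Finset.mem_image_of_mem _ (Finset.mem_univ k)
  have hidx' : ∀ k, idx ⟨T.ribbon k, hmem k⟩ = k := fun k => T.ribbon_injective (hidx _)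
  have hprec : ∀ r s, idx r < idx s → RibbonPrec (fun r => i (idx r)) r s := by
    intro r s hrs
    rcases (hi.1 hrs.le).lt_or_eq with h | h
    · exact Or.inl h
    · refine Or.inr ⟨h, ?_⟩
      have hlt : (idx r : ℕ) < idx s := hrs
      have e : (⟨idx r + ((idx s - idx r - 1 : ℕ) + 1), by omega⟩ : Fin T.size) = idx s := by
        apply Fin.ext
        simp only
        omega
      have h1 := contents_lt_of_label_eq hT hi (idx r) (idx s - idx r - 1) (by omega)
      rw [e] at h1
      have h2 := h1 h
      rwa [StandardRibbonTableau.contents, StandardRibbonTableau.contents, hidx, hidx] at h2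
  refine ⟨
    { ribbons := Finset.univ.image T.ribbon
      isRibbon := ?_
      disjoint := ?_
      cover := ?_
      label := fun r => i (idx r)
      total := ?_
      standard := ⟨T, hmem, ?_, ?_⟩ }, hmem, ?_, ?_, ?_⟩
  · intro r hr
    obtain ⟨k, -, rfl⟩ := Finset.mem_image.1 hr
    exact T.isRibbon k
  · intro r hr s hs hrs
    obtain ⟨k, -, rfl⟩ := Finset.mem_image.1 hr
    obtain ⟨l, -, rfl⟩ := Finset.mem_image.1 hs
    exact T.disjoint k l fun h => hrs (by rw [h])
  · rw [Finset.image_biUnion, ← T.cover]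
    rfl
  · intro r s hrs
    have hne : idx r ≠ idx s := fun h => hrs (Subtype.ext (by rw [← hidx, ← hidx, h]))
    rcases lt_or_gt_of_ne hne with h | h
    · exact Or.inl (hprec r s h)
    · exact Or.inr (hprec s r h)
  · intro r hr
    obtain ⟨k, -, hk⟩ := Finset.mem_image.1 hr
    exact ⟨k, hk⟩
  · intro k l hkl
    exact hprec _ _ (by rwa [hidx', hidx'])
  · intro r hr
    obtain ⟨k, -, hk⟩ := Finset.mem_image.1 hr
    exact ⟨k, hk⟩
  · intro k l hkl
    exact hprec _ _ (by rwa [hidx', hidx'])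
  · intro k
    simp only [hidx']

theorem tpow_pow (r : ℚ) (k : ℕ) : tpow r ^ k = tpow (k * r) := by
  rw [tpow, AddMonoidAlgebra.single_pow, one_pow, nsmul_eq_mul]
  rfl

theorem tpow_mul (r s : ℚ) : tpow r * tpow s = tpow (r + s) := by
  rw [tpow, tpow, AddMonoidAlgebra.single_mul_single, one_mul]
  rfl

/-- The expansion of a skew LLT polynomial into fundamental quasisymmetric functions. -/
theorem skewLLT_eq_finsum
    (hinj : ∀ T : StandardRibbonTableau m lam mu, Function.Injective T.contents) (r : ℚ) :
    skewLLT m lam mu (tpow r) = ∑ᶠ T : StandardRibbonTableau m lam mu,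
      tpow (T.spin * r) • fundamental T.size (descents T.contents) := by
  classical
  have : Fintype (StandardRibbonTableau m lam mu) := Fintype.ofFinite _
  ext1 d
  choose Φ hΦ using exists_isStandardization (m := m) (lam := lam) (mu := mu)
  let I : Finset (Σ T : StandardRibbonTableau m lam mu, (Fin T.size → ℕ+)) :=
    Finset.univ.sigma fun T =>
      (finite_fundamentalIndices T.size (descents T.contents) d).toFinset
  have hI : ∀ p, p ∈ I ↔ p.2 ∈ fundamentalIndices p.1.size (descents p.1.contents) d := by
    intro p
    simp [I]
  -- Standardisation matches semistandard tableaux of weight `d` with pairs of a standard tableau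
  -- and an index sequence of its fundamental function.
  have hbij : Set.BijOn Φ {S | S.weight = d} (I : Set _) := by
    refine ⟨?_, ?_, ?_⟩
    · rintro S rfl
      rw [Finset.mem_coe, hI]
      exact (hΦ S).mem_fundamentalIndices
    · intro S _ S' _ h
      have h1 := hΦ S
      rw [h] at h1
      exact h1.eq_left (hΦ S')
    · rintro ⟨T, i⟩ hp
      rw [Finset.mem_coe, hI] at hp
      obtain ⟨S, hS⟩ := exists_isStandardization_of_mem (hinj T) hp
      exact ⟨S, by rw [Set.mem_ofPred_eq, hS.weight_eq, hp.2.2], (hΦ S).eq_right hS⟩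
  have h1 : MvPowerSeries.coeff d (skewLLT m lam mu (tpow r)) =
      ∑ᶠ S ∈ {S : SemistandardRibbonTableau m lam mu | S.weight = d}, tpow r ^ S.spin := rfl
  rw [h1, finsum_mem_eq_of_bijOn Φ hbij (g := fun p => tpow (p.1.spin * r)) (by
    intro S _
    rw [(hΦ S).spin_eq, tpow_pow]), finsum_mem_coe_finset, finsum_eq_sum_of_fintype, map_sum,
    Finset.sum_sigma]
  refine Finset.sum_congr rfl fun T _ => ?_
  have h2 : MvPowerSeries.coeff d (fundamental T.size (descents T.contents)) =
    ((fundamentalIndices T.size (descents T.contents) d).ncard : Coeff) := rfl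
  dsimp only
  rw [Finset.sum_const, MvPowerSeries.coeff_smul, h2, nsmul_eq_mul, mul_comm,
    Set.ncard_eq_toFinset_card _ (finite_fundamentalIndices T.size (descents T.contents) d)]

end Semistandard

end RatShuffle

end

/-! ### The main theorem -/

theorem mainTheorem2 (m n : ℕ) (hm : 0 < m) (hn : 0 < n) (hmn : Nat.Coprime m n)
    (D : YoungDiagram) (hD : FitsUnderDiagonal m n D) :
    (∀ (ω : Equiv.Perm ℤ) (f : Fin n → ℕ), IsStable m n ω → f ∈ parkingFunctions m n D →
      IsAnderson m n ω f → positiveSet ω = dyckSet m n D) ∧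
    ∃ (ω₀ : Equiv.Perm ℤ) (lam mu : YoungDiagram),
      (IsIncreasingStable m n (dyckSet m n D) ω₀ ∧
        ∀ ω, IsIncreasingStable m n (dyckSet m n D) ω → ω = ω₀) ∧
      (mayaSet lam = dyckSet m n D ∧ IsCore m lam ∧ IsCore n lam) ∧
      mayaSet mu = jumpSet m n (dyckSet m n D) ∧
      lam ≤ mu ∧
      dyckSeries m n D =
        tpow ((delta m n + dinvPerm m n ω₀) / 2) •
          ∑ᶠ T : StandardRibbonTableau m lam mu,
            tpow (-(T.spin : ℚ) / 2) • fundamental T.size (descents T.contents) ∧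
      dyckSeries m n D =
        tpow ((delta m n + dinvPerm m n ω₀) / 2) • skewLLT m lam mu (tpow (-1 / 2)) := by
  have : NeZero n := ⟨hn.ne'⟩
  have hA := isResidueSystem_dyckGen (D := D) hmn
  have hsum := sum_dyckGen (D := D) hn hmn
  have hadd := generatedSet_dyckGen_add hD hm
  have hsort := isAdmissible_sort (A := dyckGen m n D) hm
  rw [dyckSet_eq hmn hD hm]
  obtain ⟨lam, hlam⟩ := hA.exists_mayaSet_eq hsum
  obtain ⟨hmu, -⟩ := hA.mayaSet_movedDiagram hadd hm hsort hlam n le_rfl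
  rw [hA.movedSet_self] at hmu
  set mu := movedDiagram m (dyckGen m n D) (Tuple.sort (dyckGen m n D)).symm n
  have hseries : dyckSeries m n D =
      tpow ((delta m n + dinvPerm m n (hA.affinePerm (Tuple.sort (dyckGen m n D)).symm)) / 2) •
        ∑ᶠ T : StandardRibbonTableau m lam mu,
          tpow (-(T.spin : ℚ) / 2) • fundamental T.size (descents T.contents) := by
    rw [dyckSeries_eq hmn hD hm, hA.finsum_tableau hadd hm hlam hmu, smul_finsum_mem]
    · refine finsum_mem_congr rfl fun e _ => ?_
      -- With g gaps and v generator inversions, `(δ + (δ - g)) / 2 - (g + 2v) / 2 = δ - g - v`.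
      rw [smul_smul, tpow_mul, hA.dinvPerm_affinePerm, hA.dinvPerm_affinePerm,
        generatorInversions_sort]
      congr 2
      push_cast
      ring
    · exact Set.toFinite _
  refine ⟨fun ω f hω hf h => positiveSet_eq_of_isAnderson hω hmn hD hf h,
    hA.affinePerm (Tuple.sort (dyckGen m n D)).symm, lam, mu,
    existsUnique_isIncreasingStable hm hA hsum hadd,
    ⟨hlam, isCore_of_add_mem (by rwa [hlam]), isCore_of_add_mem ?_⟩, hmu,
    hA.le_of_mayaSet hadd hm hlam hmu, hseries, ?_⟩
  · rw [hlam]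
    rintro _ ⟨i, k, rfl⟩
    exact ⟨i, k + 1, by push_cast; ring⟩
  · rw [hseries, skewLLT_eq_finsum (hA.contents_injective hadd hm hlam hmu)]
    congr 1
    refine finsum_congr fun T => ?_
    congr 2
    ring
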